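/- **Setting.** $P$ agents minimize risks over $\mathbb{R}^M$. Agent $p$ has the empirical risk $J_p(w)=\frac1{N_p}\sum_{n=1}^{N_p}Q_p(w;x_{p,n})$, $N_p\ge 1$. For some $\nu,\delta>0$, each $J_p$ is $\nu$-strongly convex and, at every data point, $Q_p(\cdot\,;x_{p,n})$ is convex and twice differentiable with a $\delta$-Lipschitz gradient (Assumption 1). The combination matrices $A_j=[a_{j,mp}]$, $j=0,1,2$, are left-stochastic (nonnegative entries, columns summing to one), the network of $A_1A_0A_2$ is strongly connected with at least one self-loop, and $q$ is its Perron vector: $q_p>0$, $\sum_p q_p=1$, with $A_jq=q$ for $j=0,1,2$ (in the consensus, CTA and ATC strategies one of the $A_j$ is a matrix $A$ with Perron vector $q$ and the other two are the identity). Let $w^o$ be the minimizer of $\sum_{p}q_pJ_p$ (this is the minimizer of the average $\frac1P\sum_pJ_p$ when the $A_j$ are doubly stochastic), let $w_p^o$ be the minimizer of $J_p$, and suppose that $\|w^o-w_p^o\|\le\xi$ for all $p$ (Assumption 2). With step size $\mu>0$, from square-integrable initial models $\boldsymbol w_{p,0}$, the privatized algorithm runs, for $i\ge1$, $$\boldsymbol\phi_{p,i-1}=\sum_m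 a_{1,mp}(\boldsymbol w_{m,i-1}+\boldsymbol g_{1,mp,i}),\quad \boldsymbol\psi_{p,i}=\sum_m a_{0,mp}(\boldsymbol\phi_{m,i-1}+\boldsymbol g_{0,mp,i})-\mu\widehat{\nabla J_p}(\boldsymbol\phi_{p,i-1}),\quad \boldsymbol w_{p,i}=\sum_m a_{2,mp}(\boldsymbol\psi_{m,i}+\boldsymbol g_{2,mp,i}).$$ The gradient noise $\boldsymbol s_{p,i}=\widehat{\nabla J_p}(\boldsymbol\phi_{p,i-1})-\nabla J_p(\boldsymbol\phi_{p,i-1})$ is square integrable and, given the past models $\mathcal F_{i-1}=\sigma(\boldsymbol w_{p,j}:1\le p\le P,\ 0\le j\le i-1)$, has mean zero and satisfies $\mathbb E[\|\boldsymbol s_{p,i}\|^2\mid\mathcal F_{i-1}]\le\mathbb E[\beta_{s,p}^2\|w^o-\boldsymbol\phi_{p,i-1}\|^2+\sigma_{s,p}^2\mid\mathcal F_{i-1}]$; put $\sigma_s^2=\sum_p\sigma_{s,p}^2$. The privacy noise is graph-homomorphic: $\sum_{p,m}q_pa_{j,mp}\boldsymbol g_{j,mp,i}=0$ almost surely for $j=0,1,2$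 and all $i$, with $\mathbb E\|\boldsymbol g_{j,mp,i}\|^2\le\kappa\sigma_g^2$, where $\kappa\geq 0$ is a fixed constant (in particular, this covers zero-mean Laplacian noise satisfying the cancellation condition, of variance proportional to $\sigma_g^2$). **Theorem.** Let $\boldsymbol w_{c,i}=\sum_pq_p\boldsymbol w_{p,i}$ be the network centroid and $\widetilde{\boldsymbol w}_{c,i}=w^o-\boldsymbol w_{c,i}$. For small enough $\mu$, the centroid converges exponentially fast, in the mean-square sense, to a neighbourhood of $w^o$, with $$\limsup_{i\to\infty}\mathbb E\|\widetilde{\boldsymbol w}_{c,i}\|^2\le O(\mu)\sigma_s^2+O(1)\sigma_g^2+O(\mu^2).$$ Precisely: there are $\mu_0>0$ and $K,C_1,C_2,C_3\ge0$ that depend only on $A_0,A_1,A_2,q,\nu,\delta,\xi,\kappa$ and $(\beta_{s,p})_p$, such that for every $\mu\in(0,\mu_0)$ there is $\gamma\in(0,1)$ with, for all such problems and noises and all $i\ge0$, $\mathbb E\|\widetilde{\boldsymbol w}_{c,i}\|^2<\infty$ and $$\mathbb E\|\widetilde{\boldsymbol w}_{c,i}\|^2\le K\gamma^i\sum_p\mathbb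 E\|w^o-\boldsymbol w_{p,0}\|^2+C_1\mu\,\sigma_s^2+C_2\sigma_g^2+C_3\mu^2,$$ and hence $\limsup_{i\to\infty}\mathbb E\|\widetilde{\boldsymbol w}_{c,i}\|^2\le C_1\mu\,\sigma_s^2+C_2\sigma_g^2+C_3\mu^2$. -/

import Mathlib

open MeasureTheory Filter Topology

universe u v

noncomputable section

namespace NetCentroid

/-- The parameter space `ℝ^M` with its Euclidean norm. -/
abbrev Param (M : ℕ) : Type := EuclideanSpace ℝ (Fin M)

/-! ### Risks -/

/-- The empirical risk `J(w) = (1/N) ∑ₙ Q(w; xₙ)` of one agent. -/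
def risk {M : ℕ} {X : Type v} (Q : Param M → X → ℝ) (N : ℕ) (x : Fin N → X)
    (w : Param M) : ℝ :=
  (1 / (N : ℝ)) * ∑ n, Q w (x n)

/-- The aggregate risk `∑ₚ qₚ Jₚ(w)`; for the uniform weights `qₚ = 1/P` it is the average risk. -/
def aggregateRisk {M P : ℕ} (q : Fin P → ℝ) (J : Fin P → Param M → ℝ) (w : Param M) : ℝ :=
  ∑ p, q p * J p w

/-- Convexity and smoothness: every risk is `ν`-strongly convex; at every data point the loss is
convex and twice differentiable, with a `δ`-Lipschitz gradient. -/
structure ConvexSmooth {M P : ℕ} {X : Type v} (ν δ : ℝ) (Q : Fin P → Param M → X → ℝ)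
    (N : Fin P → ℕ) (x : (p : Fin P) → Fin (N p) → X) : Prop where
  loss_differentiable : ∀ p n, Differentiable ℝ (fun w => Q p w (x p n))
  loss_twice_differentiable : ∀ p n, Differentiable ℝ (gradient (fun w => Q p w (x p n)))
  risk_strongly_convex : ∀ p w₁ w₂,
    risk (Q p) (N p) (x p) w₁ + inner ℝ (gradient (risk (Q p) (N p) (x p)) w₁) (w₂ - w₁)
      + ν / 2 * ‖w₂ - w₁‖ ^ 2 ≤ risk (Q p) (N p) (x p) w₂
  loss_convex : ∀ p n w₁ w₂,
    Q p w₁ (x p n) + inner ℝ (gradient (fun w => Q p w (x p n)) w₁) (w₂ - w₁) ≤ Q p w₂ (x p n)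
  loss_gradient_lipschitz : ∀ p n w₁ w₂,
    ‖gradient (fun w => Q p w (x p n)) w₂ - gradient (fun w => Q p w (x p n)) w₁‖
      ≤ δ * ‖w₂ - w₁‖

/-! ### Combination matrices -/

/-- The combination policy `A₀, A₁, A₂` with Perron vector `q`. The entry `A j m p` is the weight
with which agent `p` scales what it receives from agent `m`. Consensus, CTA and ATC diffusion are
the cases in which one of the matrices is a left-stochastic matrix of a strongly connected network
with a self-loop and the other two are the identity. -/
structure CombinationPolicy {P : ℕ} (A : Fin 3 → Matrix (Fin P) (Fin P) ℝ)
    (q : Fin P → ℝ) : Prop where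
  left_stochastic : ∀ j, A j ∈ Matrix.colStochastic ℝ (Fin P)
  /-- The network is strongly connected. -/
  strongly_connected : (A 1 * A 0 * A 2).IsIrreducible
  /-- At least one agent has a self-loop. -/
  self_loop : ∃ p, 0 < (A 1 * A 0 * A 2) p p
  perron : ∀ j, (A j).mulVec q = q
  perron_pos : ∀ p, 0 < q p
  perron_sum : ∑ p, q p = 1

/-! ### The privatized algorithm -/

/-- Combination of perturbed messages: agent `p` forms `∑ₘ aₘₚ (yₘ + gₘₚ)`. -/
def combine {M P : ℕ} (a : Matrix (Fin P) (Fin P) ℝ) (y : Fin P → Param M)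
    (g : Fin P → Fin P → Param M) (p : Fin P) : Param M :=
  ∑ m, a m p • (y m + g m p)

/-- One step `𝓦 ↦ 𝓦'` of the privatized algorithm with step size `μ`: pre-combination,
adaptation with the approximate gradients `G p`, post-combination. Here `g j m p` is the noise that
is added to the message from `m` to `p` in the combination with `A j`. -/
def step {M P : ℕ} (A : Fin 3 → Matrix (Fin P) (Fin P) ℝ) (μ : ℝ)
    (G : Fin P → Param M → Param M) (g : Fin 3 → Fin P → Fin P → Param M)
    (W : Fin P → Param M) : Fin P → Param M :=
  let φ : Fin P → Param M := combine (A 1) W (g 1)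
  let ψ : Fin P → Param M := fun p => combine (A 0) φ (g 0) p - μ • G p (φ p)
  combine (A 2) ψ (g 2)

section Iterations

variable {Ω : Type u} {M P : ℕ}

/-- The models `w_{p,i}`. `G i p ω` is the approximation of `∇Jₚ` used by agent `p` at iteration
`i`, and `g j i m p` is the noise added at iteration `i` (`i = 1, 2, …`). -/
def models (A : Fin 3 → Matrix (Fin P) (Fin P) ℝ) (μ : ℝ)
    (G : ℕ → Fin P → Ω → Param M → Param M)
    (g : Fin 3 → ℕ → Fin P → Fin P → Ω → Param M) (w₀ : Fin P → Ω → Param M) :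
    ℕ → Fin P → Ω → Param M
  | 0 => w₀
  | i + 1 => fun p ω =>
      step A μ (fun p => G (i + 1) p ω) (fun j m p => g j (i + 1) m p ω)
        (fun p => models A μ G g w₀ i p ω) p

/-- `φ_{p,i}`, the pre-combined models, from which iteration `i + 1` computes its gradients. -/
def preModels (A : Fin 3 → Matrix (Fin P) (Fin P) ℝ) (μ : ℝ)
    (G : ℕ → Fin P → Ω → Param M → Param M)
    (g : Fin 3 → ℕ → Fin P → Fin P → Ω → Param M) (w₀ : Fin P → Ω → Param M)
    (i : ℕ) (p : Fin P) (ω : Ω) : Param M :=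
  combine (A 1) (fun m => models A μ G g w₀ i m ω) (fun m p => g 1 (i + 1) m p ω) p

/-- The network centroid `w_{c,i} = ∑ₚ qₚ w_{p,i}`. -/
def centroid (q : Fin P → ℝ) (W : ℕ → Fin P → Ω → Param M) (i : ℕ) (ω : Ω) : Param M :=
  ∑ p, q p • W i p ω

/-- The σ-algebra generated by the models `w_{p,j}`, `j ≤ i`. -/
abbrev pastModels (W : ℕ → Fin P → Ω → Param M) (i : ℕ) : MeasurableSpace Ω :=
  ⨆ j : Fin (i + 1), ⨆ p : Fin P, MeasurableSpace.comap (W j p) inferInstance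

/-- Graph-homomorphic noise: square integrable, of second moment at most `κ σg²` on every link, and
with `∑ qₚ a_{j,mp} g_{j,mp,i} = 0` at every iteration. -/
structure GraphHomomorphicNoise [MeasurableSpace Ω] (ℙ : Measure Ω)
    (A : Fin 3 → Matrix (Fin P) (Fin P) ℝ) (q : Fin P → ℝ) (κ σg : ℝ)
    (g : Fin 3 → ℕ → Fin P → Fin P → Ω → Param M) : Prop where
  measurable : ∀ j i m p, Measurable (g j i m p)
  memLp : ∀ j i m p, MemLp (g j i m p) 2 ℙ
  second_moment : ∀ j i m p, ∫ ω, ‖g j i m p ω‖ ^ 2 ∂ℙ ≤ κ * σg ^ 2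
  cancel : ∀ j i, ∀ᵐ ω ∂ℙ, ∑ p, ∑ m, (q p * A j m p) • g j i m p ω = 0

/-- The gradient noise `s_{p,i+1}` (written `s i p`), incurred at the point `φ_{p,i}` (written
`φ i p`), has conditional mean zero given the past models, and a conditional second moment that is
bounded in terms of the model error at `φ_{p,i}`. -/
structure GradientNoise [MeasurableSpace Ω] (ℙ : Measure Ω) (β σs : Fin P → ℝ) (wo : Param M)
    (W φ s : ℕ → Fin P → Ω → Param M) : Prop where
  measurable : ∀ i p, Measurable (s i p)
  memLp : ∀ i p, MemLp (s i p) 2 ℙ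
  zero_mean : ∀ i p, ℙ[s i p | pastModels W i] =ᵐ[ℙ] 0
  second_moment : ∀ i p, ℙ[fun ω => ‖s i p ω‖ ^ 2 | pastModels W i]
    ≤ᵐ[ℙ] ℙ[fun ω => β p ^ 2 * ‖wo - φ i p ω‖ ^ 2 + σs p ^ 2 | pastModels W i]

end Iterations

end NetCentroid

end

/-! ### Combination matrices: primitivity, weighted averages, and a contracting norm. -/

section Matrices

namespace Matrix

variable {ι : Type*} [Fintype ι] [DecidableEq ι]

/-! The network state is split into its `q`-weighted average (the centroid) and the deviations from
it, and two mean-square recursions are coupled.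

Centroid: since each `A j` fixes `q` and the combined privacy noises have weighted average zero,
averaging leaves a stochastic gradient step, in which privacy noise appears only through the points
`φ` where gradients are evaluated (`avg_step`). Moving those evaluations to the centroid leaves
three terms: a gradient step for the aggregate risk, contracting by `1 - μν` in square; a Lipschitz
bias controlled by the deviations and the first privacy noise; and the averaged gradient noise.
Young's inequality spends half of the contraction on the bias, at a cost of order `μ`. The gradient
noise is orthogonal to functions of the past models, so it costs only order `μ²` (`error_succ_le`,
`cross_term`).

Deviations: the product of the combination matrices is primitive, hence contracts vectors of zero
weighted average in an adapted norm (`exists_contracting_norm`). The rest of the step is a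
perturbation by privacy noise of order one and gradients of order `μ` (`dev_succ_le`).

With centroid error `e` and disagreement `V`, the function `e + kμV` contracts by `1 - μν/4`, with
forcing `μ · (O(1) σg² + O(μ) σs² + O(μ²))`. Dividing by `μν/4` gives the three terms of the bound
(`exists_coupled_recursion_bound`). No independence between the noises is used: the privacy terms
enter only through norms. -/

theorem pow_mul_pow_apply_pos {B : Matrix ι ι ℝ} (hB : ∀ i j, 0 ≤ B i j) {k l : ℕ} {i j p : ι}
    (h₁ : 0 < (B ^ k) i p) (h₂ : 0 < (B ^ l) p j) : 0 < (B ^ (k + l)) i j := by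
  rw [pow_add, mul_apply]
  exact Finset.sum_pos' (fun x _ => mul_nonneg (pow_apply_nonneg hB k i x)
    (pow_apply_nonneg hB l x j)) ⟨p, Finset.mem_univ p, mul_pos h₁ h₂⟩

theorem pow_apply_self_pos {B : Matrix ι ι ℝ} (hB : ∀ i j, 0 ≤ B i j) {p : ι} (hp : 0 < B p p)
    (k : ℕ) : 0 < (B ^ k) p p := by
  induction k with
  | zero => simp
  | succ k ih => exact pow_mul_pow_apply_pos hB ih (by simpa using hp)

/-- An irreducible matrix with a positive diagonal entry is primitive. -/
theorem IsIrreducible.isPrimitive_of_diag_pos {B : Matrix ι ι ℝ} (hB : B.IsIrreducible) {p : ι}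
    (hp : 0 < B p p) : B.IsPrimitive := by
  have hirr := (isIrreducible_iff_exists_pow_pos hB.nonneg).1 hB
  choose k hk hkp using fun i => hirr i p
  choose l hl hlp using fun j => hirr p j
  -- One exponent serves all pairs: go from `i` to `p` in `k i` steps, spend the surplus on the loop
  -- at `p`, then reach `j` in `l j` steps.
  refine ⟨hB.nonneg, ∑ i, k i + ∑ j, l j, ?_, fun i j => ?_⟩
  · exact Nat.add_pos_left ((hk p).trans_le
      (Finset.single_le_sum (f := k) (fun _ _ => Nat.zero_le _) (Finset.mem_univ p))) _
  · have h₁ := Finset.single_le_sum (f := k) (fun _ _ => Nat.zero_le _) (Finset.mem_univ i)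
    have h₂ := Finset.single_le_sum (f := l) (fun _ _ => Nat.zero_le _) (Finset.mem_univ j)
    obtain ⟨s, hs⟩ : ∃ s, ∑ i, k i + ∑ j, l j = k i + (s + l j) :=
      ⟨∑ i, k i + ∑ j, l j - k i - l j, by omega⟩
    rw [hs]
    exact pow_mul_pow_apply_pos hB.nonneg (hkp i)
      (pow_mul_pow_apply_pos hB.nonneg (pow_apply_self_pos hB.nonneg hp s) (hlp j))

end Matrix

namespace NetCentroid

variable {P : ℕ} {E : Type*} [NormedAddCommGroup E] [NormedSpace ℝ E]

/-- The combination `x ↦ (∑ₘ aₘₚ xₘ)ₚ` of the agents' vectors. -/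
def mix (a : Matrix (Fin P) (Fin P) ℝ) : (Fin P → E) →ₗ[ℝ] (Fin P → E) where
  toFun x p := ∑ m, a m p • x m
  map_add' x y := by ext1 p; simp [smul_add, Finset.sum_add_distrib]
  map_smul' c x := by ext1 p; simp [Finset.smul_sum, smul_comm c]

theorem mix_apply (a : Matrix (Fin P) (Fin P) ℝ) (x : Fin P → E) (p : Fin P) :
    mix a x p = ∑ m, a m p • x m := rfl

/-- The weighted average `∑ₚ qₚ xₚ`. -/
def avg (q : Fin P → ℝ) : (Fin P → E) →ₗ[ℝ] E where
  toFun x := ∑ p, q p • x p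
  map_add' x y := by simp [smul_add, Finset.sum_add_distrib]
  map_smul' c x := by simp [Finset.smul_sum, smul_comm c]

theorem avg_apply (q : Fin P → ℝ) (x : Fin P → E) : avg q x = ∑ p, q p • x p := rfl

/-- Weights are read along columns, so `mix` acts as the transpose and reverses products. Thus `A 1
* A 0 * A 2` is pre-combination, then adaptation, then post-combination. -/
theorem mix_mul (a b : Matrix (Fin P) (Fin P) ℝ) (x : Fin P → E) :
    mix (a * b) x = mix b (mix a x) := by
  ext1 p
  simp only [mix_apply, Matrix.mul_apply, Finset.sum_smul, Finset.smul_sum, smul_smul]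
  rw [Finset.sum_comm]
  simp only [mul_comm]

theorem mix_one (x : Fin P → E) : mix 1 x = x := by
  ext1 p
  simp [mix_apply, Matrix.one_apply]

theorem mix_const {a : Matrix (Fin P) (Fin P) ℝ} (ha : a ∈ Matrix.colStochastic ℝ (Fin P))
    (c : E) : mix a (fun _ => c) = fun _ => c := by
  ext1 p
  rw [mix_apply, ← Finset.sum_smul, Matrix.sum_col_of_mem_colStochastic ha, one_smul]

theorem norm_mix_le {a : Matrix (Fin P) (Fin P) ℝ} (ha : a ∈ Matrix.colStochastic ℝ (Fin P))
    (x : Fin P → E) : ‖mix a x‖ ≤ ‖x‖ := by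
  refine (pi_norm_le_iff_of_nonneg (norm_nonneg x)).2 fun p => ?_
  calc ‖mix a x p‖ ≤ ∑ m, a m p * ‖x‖ := by
        rw [mix_apply]
        refine norm_sum_le_of_le _ fun m _ => ?_
        rw [norm_smul, Real.norm_of_nonneg (Matrix.nonneg_of_mem_colStochastic ha)]
        exact mul_le_mul_of_nonneg_left (norm_le_pi_norm x m)
          (Matrix.nonneg_of_mem_colStochastic ha)
    _ = ‖x‖ := by
        rw [← Finset.sum_mul, Matrix.sum_col_of_mem_colStochastic ha, one_mul]

theorem avg_mix {a : Matrix (Fin P) (Fin P) ℝ} {q : Fin P → ℝ} (ha : a.mulVec q = q)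
    (x : Fin P → E) : avg q (mix a x) = avg q x := by
  simp only [avg_apply, mix_apply, Finset.smul_sum, smul_smul]
  rw [Finset.sum_comm]
  refine Finset.sum_congr rfl fun m _ => ?_
  rw [← Finset.sum_smul]
  congr 1
  rw [← congrFun ha m, Matrix.mulVec, dotProduct]
  simp only [mul_comm]

theorem avg_const {q : Fin P → ℝ} (hq : ∑ p, q p = 1) (c : E) : avg q (fun _ => c) = c := by
  rw [avg_apply, ← Finset.sum_smul, hq, one_smul]

theorem norm_avg_le {q : Fin P → ℝ} (hq₀ : ∀ p, 0 ≤ q p) (hq : ∑ p, q p = 1) (x : Fin P → E) :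
    ‖avg q x‖ ≤ ‖x‖ := by
  calc ‖avg q x‖ ≤ ∑ p, q p * ‖x‖ := by
        rw [avg_apply]
        refine norm_sum_le_of_le _ fun m _ => ?_
        rw [norm_smul, Real.norm_of_nonneg (hq₀ m)]
        exact mul_le_mul_of_nonneg_left (norm_le_pi_norm x m) (hq₀ m)
    _ = ‖x‖ := by rw [← Finset.sum_mul, hq, one_mul]

/-- The deviation of the agents' vectors from their weighted average. -/
def dev (q : Fin P → ℝ) : (Fin P → E) →ₗ[ℝ] (Fin P → E) :=
  LinearMap.id - LinearMap.pi fun _ => avg q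

theorem dev_eq (q : Fin P → ℝ) (x : Fin P → E) : dev q x = x - fun _ => avg q x := rfl

theorem avg_dev {q : Fin P → ℝ} (hq : ∑ p, q p = 1) (x : Fin P → E) : avg q (dev q x) = 0 := by
  rw [dev_eq, map_sub, avg_const hq, sub_self]

theorem dev_const {q : Fin P → ℝ} (hq : ∑ p, q p = 1) (c : E) : dev q (fun _ => c) = 0 := by
  rw [dev_eq, avg_const hq, sub_self]

theorem dev_mix {a : Matrix (Fin P) (Fin P) ℝ} {q : Fin P → ℝ}
    (ha : a ∈ Matrix.colStochastic ℝ (Fin P)) (haq : a.mulVec q = q) (x : Fin P → E) :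
    dev q (mix a x) = mix a (dev q x) := by
  rw [dev_eq, dev_eq, map_sub, mix_const ha, avg_mix haq]

theorem norm_dev_le {q : Fin P → ℝ} (hq₀ : ∀ p, 0 ≤ q p) (hq : ∑ p, q p = 1) (x : Fin P → E) :
    ‖dev q x‖ ≤ 2 * ‖x‖ := by
  have h : ‖(fun _ => avg q x : Fin P → E)‖ ≤ ‖x‖ :=
    (pi_norm_le_iff_of_nonneg (norm_nonneg x)).2 fun _ => norm_avg_le hq₀ hq x
  rw [dev_eq]
  linarith [norm_sub_le x (fun _ => avg q x)]

/-- A column-stochastic matrix with positive entries contracts the sup norm on the vectors of zero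
weighted average. -/
theorem norm_mix_le_of_pos {a : Matrix (Fin P) (Fin P) ℝ} {q : Fin P → ℝ}
    (ha : a ∈ Matrix.colStochastic ℝ (Fin P)) (hq : ∑ p, q p = 1)
    {ε : ℝ} (hε : ∀ m p, ε * q m ≤ a m p) {x : Fin P → E} (hx : avg q x = 0) (hε₁ : ε ≤ 1) :
    ‖mix a x‖ ≤ (1 - ε) * ‖x‖ := by
  refine (pi_norm_le_iff_of_nonneg (mul_nonneg (by linarith) (norm_nonneg x))).2 fun p => ?_
  -- Doeblin minorization: subtracting `ε q` from each column changes nothing on vectors of zero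
  -- average and leaves nonnegative weights of sum `1 - ε`.
  have h : mix a x p = ∑ m, (a m p - ε * q m) • x m := by
    simp only [sub_smul, Finset.sum_sub_distrib, mul_smul, ← Finset.smul_sum]
    rw [avg_apply] at hx
    rw [hx, smul_zero, sub_zero, mix_apply]
  calc ‖mix a x p‖ ≤ ∑ m, (a m p - ε * q m) * ‖x‖ := by
        rw [h]
        refine norm_sum_le_of_le _ fun m _ => ?_
        rw [norm_smul, Real.norm_of_nonneg (sub_nonneg.2 (hε m p))]
        exact mul_le_mul_of_nonneg_left (norm_le_pi_norm x m) (sub_nonneg.2 (hε m p))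
    _ = (1 - ε) * ‖x‖ := by
        rw [← Finset.sum_mul, Finset.sum_sub_distrib, Matrix.sum_col_of_mem_colStochastic ha,
          ← Finset.mul_sum, hq, mul_one]

theorem continuous_mix (a : Matrix (Fin P) (Fin P) ℝ) :
    Continuous (mix a : (Fin P → E) →ₗ[ℝ] (Fin P → E)) := by
  have : (mix a : (Fin P → E) → (Fin P → E)) = fun x p => ∑ m, a m p • x m := rfl
  rw [this]
  fun_prop

theorem continuous_avg (q : Fin P → ℝ) : Continuous (avg q : (Fin P → E) →ₗ[ℝ] E) := by
  have : (avg q : (Fin P → E) → E) = fun x => ∑ m, q m • x m := rfl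
  rw [this]
  fun_prop

/-- The size `∑_{k<n} r⁻ᵏ ‖mix (bᵏ) x‖`, in which `mix b` contracts by `r` as soon as `mix (bⁿ)`
contracts the sup norm by `rⁿ`. -/
noncomputable def adaptedNorm (b : Matrix (Fin P) (Fin P) ℝ) (r : ℝ) (n : ℕ) (x : Fin P → E) : ℝ :=
  ∑ k ∈ Finset.range n, (r ^ k)⁻¹ * ‖mix (b ^ k) x‖

/-- Applying `mix b` shifts the weighted sum by one index, at the price of a factor `r`. The new
last term is dominated by the lost term `k = 0` through the hypothesis on `b ^ n`. -/
theorem adaptedNorm_mix_le {b : Matrix (Fin P) (Fin P) ℝ} {r : ℝ} (hr : 0 < r) {n : ℕ}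
    (hn : 0 < n) {x : Fin P → E} (hx : ‖mix (b ^ n) x‖ ≤ r ^ n * ‖x‖) :
    adaptedNorm b r n (mix b x) ≤ r * adaptedNorm b r n x := by
  obtain ⟨n, rfl⟩ := Nat.exists_eq_succ_of_ne_zero hn.ne'
  have h : adaptedNorm b r (n + 1) (mix b x)
      = r * ∑ k ∈ Finset.range (n + 1), (r ^ (k + 1))⁻¹ * ‖mix (b ^ (k + 1)) x‖ := by
    rw [adaptedNorm, Finset.mul_sum]
    refine Finset.sum_congr rfl fun k _ => ?_
    rw [← mix_mul, ← pow_succ', pow_succ r]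
    field_simp
  rw [h, adaptedNorm, Nat.succ_eq_add_one, Finset.sum_range_succ, Finset.sum_range_succ']
  refine mul_le_mul_of_nonneg_left (add_le_add_right ?_ _) hr.le
  rw [pow_zero, pow_zero, mix_one, inv_one, one_mul, inv_mul_le_iff₀ (by positivity)]
  exact hx

/-- The constants `r` and `C` precede the dimension `M`, because the final constants may not depend
on it. Continuity of the norm serves measurability later. -/
theorem exists_contracting_norm {A : Fin 3 → Matrix (Fin P) (Fin P) ℝ} {q : Fin P → ℝ}
    (hA : CombinationPolicy A q) :
    ∃ r C : ℝ, 0 < r ∧ r < 1 ∧ 0 ≤ C ∧ ∀ M : ℕ, ∃ N : (Fin P → Param M) → ℝ,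
      Continuous N ∧ (∀ x y, N (x + y) ≤ N x + N y) ∧ (∀ x, ‖x‖ ≤ N x) ∧ (∀ x, N x ≤ C * ‖x‖) ∧
      ∀ x, avg q x = 0 → N (mix (A 1 * A 0 * A 2) x) ≤ r * N x := by
  have hst : A 1 * A 0 * A 2 ∈ Matrix.colStochastic ℝ (Fin P) :=
    mul_mem (mul_mem (hA.left_stochastic 1) (hA.left_stochastic 0)) (hA.left_stochastic 2)
  obtain ⟨p₀, hp₀⟩ := hA.self_loop
  obtain ⟨n, hn, hpos⟩ := (hA.strongly_connected.isPrimitive_of_diag_pos hp₀).exists_pos_pow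
  set B := A 1 * A 0 * A 2 with hB
  have : Nonempty (Fin P × Fin P) := ⟨(p₀, p₀)⟩
  obtain ⟨i₀, hi₀⟩ := Finite.exists_min fun i : Fin P × Fin P => (B ^ n) i.1 i.2
  -- The least entry of the positive power, capped at `1/2` so that `1 - ε / n` stays positive.
  set ε := min ((B ^ n) i₀.1 i₀.2) (1 / 2) with hε
  have hε₀ : 0 < ε := lt_min (hpos _ _) (by norm_num)
  have hε₁ : ε ≤ 1 / 2 := min_le_right _ _
  have hn' : (1 : ℝ) ≤ n := by exact_mod_cast hn
  have hq₁ : ∀ m, q m ≤ 1 := fun m => by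
    rw [← hA.perron_sum]
    exact Finset.single_le_sum (fun i _ => (hA.perron_pos i).le) (Finset.mem_univ m)
  have hεn : ε / n ≤ 1 / 2 := (div_le_self hε₀.le hn').trans hε₁
  have hr : 0 < 1 - ε / n := by linarith
  -- Bernoulli's inequality: the contraction `1 - ε` over `n` steps is turned into the rate `1 - ε /
  -- n` per step.
  have hber : 1 - ε ≤ (1 - ε / n) ^ n := by
    have := one_add_mul_le_pow (a := -(ε / n)) (by linarith) n
    have h2 : (n : ℝ) * -(ε / n) = -ε := by field_simp
    rw [h2] at this
    simpa [sub_eq_add_neg] using this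
  refine ⟨1 - ε / n, ∑ k ∈ Finset.range n, ((1 - ε / n) ^ k)⁻¹, hr,
    by linarith [div_pos hε₀ (by linarith : (0 : ℝ) < n)],
    Finset.sum_nonneg fun k _ => by positivity, fun M => ⟨adaptedNorm B (1 - ε / n) n, ?_⟩⟩
  refine ⟨?_, fun x y => ?_, fun x => ?_, fun x => ?_, fun x hx => ?_⟩
  · exact continuous_finsetSum _ fun k _ => continuous_const.mul (continuous_mix _).norm
  · simp only [adaptedNorm, ← Finset.sum_add_distrib, ← mul_add, map_add]
    gcongr
    exact norm_add_le _ _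
  · have := Finset.single_le_sum (f := fun k => ((1 - ε / n) ^ k)⁻¹ * ‖mix (B ^ k) x‖)
      (fun k _ => by positivity) (Finset.mem_range.2 hn)
    simpa [mix_one, adaptedNorm] using this
  · rw [adaptedNorm, Finset.sum_mul]
    gcongr with k
    exact norm_mix_le (pow_mem hst k) x
  · refine adaptedNorm_mix_le hr hn ((norm_mix_le_of_pos (pow_mem hst n) hA.perron_sum (ε := ε)
      (fun m p => ?_) hx (by linarith)).trans (by gcongr))
    calc ε * q m ≤ ε * 1 := mul_le_mul_of_nonneg_left (hq₁ m) hε₀.le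
      _ ≤ (B ^ n) m p := by rw [mul_one]; exact (min_le_left _ _).trans (hi₀ (m, p))

end NetCentroid

end Matrices

/-! ### Gradients of the risks and contraction of the aggregate gradient step. -/

section Risks

namespace NetCentroid

variable {M P : ℕ} {X : Type v}

theorem hasGradientAt_risk {Q : Param M → X → ℝ} {N : ℕ} {x : Fin N → X}
    (hQ : ∀ n, Differentiable ℝ (fun w => Q w (x n))) (w : Param M) :
    HasGradientAt (risk Q N x)
      ((1 / (N : ℝ)) • ∑ n, gradient (fun w => Q w (x n)) w) w := by
  have h : HasFDerivAt (fun w => (1 / (N : ℝ)) * ∑ n, Q w (x n))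
      ((1 / (N : ℝ)) • ∑ n, fderiv ℝ (fun w => Q w (x n)) w) w :=
    (HasFDerivAt.fun_sum fun n _ => (hQ n w).hasFDerivAt).const_mul _
  have hd : HasGradientAt (fun w => (1 / (N : ℝ)) * ∑ n, Q w (x n)) _ w := h.hasGradientAt
  have hf : risk Q N x = fun w => (1 / (N : ℝ)) * ∑ n, Q w (x n) := rfl
  rw [hf]
  simpa [gradient] using hd

theorem gradient_risk {Q : Param M → X → ℝ} {N : ℕ} {x : Fin N → X}
    (hQ : ∀ n, Differentiable ℝ (fun w => Q w (x n))) (w : Param M) :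
    gradient (risk Q N x) w = (1 / (N : ℝ)) • ∑ n, gradient (fun w => Q w (x n)) w :=
  (hasGradientAt_risk hQ w).gradient

theorem gradient_risk_lipschitz {Q : Param M → X → ℝ} {N : ℕ} (hN : 0 < N) {x : Fin N → X} {δ : ℝ}
    (hQ : ∀ n, Differentiable ℝ (fun w => Q w (x n)))
    (hδ : ∀ n w₁ w₂, ‖gradient (fun w => Q w (x n)) w₂ - gradient (fun w => Q w (x n)) w₁‖
      ≤ δ * ‖w₂ - w₁‖) (w₁ w₂ : Param M) :
    ‖gradient (risk Q N x) w₂ - gradient (risk Q N x) w₁‖ ≤ δ * ‖w₂ - w₁‖ := by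
  have hN' : (0 : ℝ) < N := by exact_mod_cast hN
  rw [gradient_risk hQ, gradient_risk hQ, ← smul_sub, ← Finset.sum_sub_distrib, norm_smul,
    Real.norm_of_nonneg (by positivity)]
  calc 1 / (N : ℝ) * _ ≤ 1 / (N : ℝ) * ∑ _n : Fin N, δ * ‖w₂ - w₁‖ := by
        gcongr
        exact norm_sum_le_of_le _ fun n _ => hδ n w₁ w₂
    _ = δ * ‖w₂ - w₁‖ := by
        simp only [Finset.sum_const, Finset.card_univ, Fintype.card_fin, nsmul_eq_mul]
        field_simp

theorem strongly_monotone_of_strongly_convex {f : Param M → ℝ} {f' : Param M → Param M} {ν : ℝ}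
    (h : ∀ w₁ w₂, f w₁ + inner ℝ (f' w₁) (w₂ - w₁) + ν / 2 * ‖w₂ - w₁‖ ^ 2 ≤ f w₂)
    (w₁ w₂ : Param M) : ν * ‖w₂ - w₁‖ ^ 2 ≤ inner ℝ (f' w₂ - f' w₁) (w₂ - w₁) := by
  have h₁ := h w₁ w₂
  have h₂ := h w₂ w₁
  rw [norm_sub_rev w₁ w₂, ← neg_sub w₂ w₁, inner_neg_right] at h₂
  rw [inner_sub_left]
  linarith

/-- Gradient fields `F p` that are `ν`-strongly monotone and `δ`-Lipschitz, have weighted sum zero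
at `wo`, and are of size at most `δ ξ` there. -/
structure GradientFields (ν δ ξ : ℝ) (q : Fin P → ℝ) (wo : Param M)
    (F : Fin P → Param M → Param M) : Prop where
  lipschitz : ∀ p w₁ w₂, ‖F p w₂ - F p w₁‖ ≤ δ * ‖w₂ - w₁‖
  monotone : ∀ p w₁ w₂, ν * ‖w₂ - w₁‖ ^ 2 ≤ inner ℝ (F p w₂ - F p w₁) (w₂ - w₁)
  critical : ∑ p, q p • F p wo = 0
  drift : ∀ p, ‖F p wo‖ ≤ δ * ξ

/-- Collects all that the recursions need from the risks. The aggregate gradient vanishes at `wo` by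
Fermat's rule, and each local gradient vanishes at `wloc p`, so the Lipschitz bound turns the drift
`ξ` into `δ ξ`. -/
theorem ConvexSmooth.gradientFields {ν δ ξ : ℝ} (hδ : 0 ≤ δ) {q : Fin P → ℝ}
    {Q : Fin P → Param M → X → ℝ} {N : Fin P → ℕ} (hN : ∀ p, 0 < N p)
    {x : (p : Fin P) → Fin (N p) → X} (hQ : ConvexSmooth ν δ Q N x)
    {wo : Param M} {wloc : Fin P → Param M}
    (hwo : IsMinOn (aggregateRisk q (fun p => risk (Q p) (N p) (x p))) Set.univ wo)
    (hwloc : ∀ p, IsMinOn (risk (Q p) (N p) (x p)) Set.univ (wloc p))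
    (hdrift : ∀ p, ‖wo - wloc p‖ ≤ ξ) :
    GradientFields ν δ ξ q wo (fun p => gradient (risk (Q p) (N p) (x p))) := by
  have hlip : ∀ p w₁ w₂, ‖gradient (risk (Q p) (N p) (x p)) w₂
      - gradient (risk (Q p) (N p) (x p)) w₁‖ ≤ δ * ‖w₂ - w₁‖ := fun p =>
    gradient_risk_lipschitz (hN p) (hQ.loss_differentiable p) (hQ.loss_gradient_lipschitz p)
  have hdiff : ∀ p w, HasGradientAt (risk (Q p) (N p) (x p))
      (gradient (risk (Q p) (N p) (x p)) w) w := fun p w =>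
    (hasGradientAt_risk (hQ.loss_differentiable p) w).differentiableAt.hasGradientAt
  refine ⟨hlip, fun p => strongly_monotone_of_strongly_convex (hQ.risk_strongly_convex p), ?_,
    fun p => ?_⟩
  · have hsum : HasFDerivAt (aggregateRisk q (fun p => risk (Q p) (N p) (x p)))
        (∑ p, q p • fderiv ℝ (risk (Q p) (N p) (x p)) wo) wo :=
      HasFDerivAt.fun_sum fun p _ => ((hdiff p wo).differentiableAt.hasFDerivAt).const_mul _
    have h0 := (hwo.isLocalMin univ_mem).hasFDerivAt_eq_zero hsum
    have := congrArg (InnerProductSpace.toDual ℝ (Param M)).symm h0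
    simpa [gradient] using this
  · have h0 : gradient (risk (Q p) (N p) (x p)) (wloc p) = 0 := by
      rw [gradient, ((hwloc p).isLocalMin univ_mem).fderiv_eq_zero, map_zero]
    have := hlip p (wloc p) wo
    rw [h0, sub_zero] at this
    exact this.trans (mul_le_mul_of_nonneg_left (hdrift p) hδ)

namespace GradientFields

variable {ν δ ξ : ℝ} {q : Fin P → ℝ} {wo : Param M} {F : Fin P → Param M → Param M}

theorem norm_le (h : GradientFields ν δ ξ q wo F) (p : Fin P) (w : Param M) :
    ‖F p w‖ ≤ δ * (‖wo - w‖ + ξ) := by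
  have h₁ := h.lipschitz p wo w
  have h₂ := norm_add_le (F p w - F p wo) (F p wo)
  rw [sub_add_cancel] at h₂
  rw [norm_sub_rev w wo] at h₁
  linarith [h.drift p]

/-- The gradient step for the aggregate risk contracts the distance to the minimizer. -/
theorem norm_sq_step_le (h : GradientFields ν δ ξ q wo F) (hq₀ : ∀ p, 0 ≤ q p)
    (hq : ∑ p, q p = 1) {μ : ℝ} (hμ : 0 ≤ μ) (hμδ : μ * δ ^ 2 ≤ ν) (w : Param M) :
    ‖wo - w + μ • ∑ p, q p • F p w‖ ^ 2 ≤ (1 - μ * ν) * ‖wo - w‖ ^ 2 := by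
  -- Criticality of `wo` allows subtracting the gradients there, so that only differences remain.
  have hs : ∑ p, q p • F p w = -avg q (fun p => F p wo - F p w) := by
    simp only [avg_apply, smul_sub, Finset.sum_sub_distrib, h.critical]
    abel
  set v := avg q (fun p => F p wo - F p w) with hv
  have hvn : ‖v‖ ≤ δ * ‖wo - w‖ := by
    calc ‖v‖ ≤ ∑ p, q p * (δ * ‖wo - w‖) := by
          rw [hv, avg_apply]
          refine norm_sum_le_of_le _ fun p _ => ?_
          rw [norm_smul, Real.norm_of_nonneg (hq₀ p)]
          exact mul_le_mul_of_nonneg_left (h.lipschitz p w wo) (hq₀ p)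
      _ = δ * ‖wo - w‖ := by rw [← Finset.sum_mul, hq, one_mul]
  have hvi : ν * ‖wo - w‖ ^ 2 ≤ inner ℝ (wo - w) v := by
    calc ν * ‖wo - w‖ ^ 2 = ∑ p, q p * (ν * ‖wo - w‖ ^ 2) := by
          rw [← Finset.sum_mul, hq, one_mul]
      _ ≤ ∑ p, q p * inner ℝ (F p wo - F p w) (wo - w) :=
          Finset.sum_le_sum fun p _ => mul_le_mul_of_nonneg_left (h.monotone p w wo) (hq₀ p)
      _ = inner ℝ (wo - w) v := by
          rw [hv, avg_apply, inner_sum]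
          simp only [real_inner_smul_right, real_inner_comm]
  have hv2 : ‖v‖ ^ 2 ≤ δ ^ 2 * ‖wo - w‖ ^ 2 := by
    rw [← mul_pow]
    exact pow_le_pow_left₀ (norm_nonneg _) hvn 2
  rw [hs, smul_neg, ← sub_eq_add_neg, norm_sub_sq_real, real_inner_smul_right, norm_smul, mul_pow,
    Real.norm_of_nonneg hμ]
  -- The condition `μ δ² ≤ ν` makes the quadratic term cost at most half of the gain `2μν` from
  -- monotonicity.
  have h₁ : μ ^ 2 * ‖v‖ ^ 2 ≤ μ * ν * ‖wo - w‖ ^ 2 := by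
    calc μ ^ 2 * ‖v‖ ^ 2 ≤ μ ^ 2 * (δ ^ 2 * ‖wo - w‖ ^ 2) := by gcongr
      _ = μ * (μ * δ ^ 2) * ‖wo - w‖ ^ 2 := by ring
      _ ≤ μ * ν * ‖wo - w‖ ^ 2 := by gcongr
  have h₂ := mul_le_mul_of_nonneg_left hvi hμ
  linarith

end GradientFields

end NetCentroid

end Risks

/-! ### Deterministic stability of the coupled recursion. -/

section Recursion

/-- `B` is the fixed point of the affine recursion, so `L - B` decays geometrically. -/
theorem le_geometric_of_le_mul_add {L : ℕ → ℝ} {ρ B : ℝ} (hρ : 0 ≤ ρ)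
    (h : ∀ i, L (i + 1) ≤ ρ * L i + (1 - ρ) * B) (hB : 0 ≤ B) (i : ℕ) :
    L i ≤ ρ ^ i * L 0 + B := by
  have h' : ∀ i, L i - B ≤ ρ ^ i * (L 0 - B) := by
    intro i
    induction i with
    | zero => simp
    | succ i ih =>
      have := mul_le_mul_of_nonneg_left ih hρ
      rw [pow_succ]
      nlinarith [h i]
  nlinarith [h' i, pow_nonneg hρ i, mul_nonneg (pow_nonneg hρ i) hB]

/-- A coupled recursion for the mean-square error `e` of the centroid, the mean-square disagreement
`V` and the gradient-noise power `S` is stable for small step sizes. -/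
theorem exists_coupled_recursion_bound {ν r c₁ c₂ b : ℝ} (hν : 0 < ν) (hr₁ : r < 1)
    (hc₁ : 0 ≤ c₁) (hc₂ : 0 ≤ c₂) (hb : 0 ≤ b) :
    ∃ μ₀ k D₁ D₂ D₃ : ℝ, 0 < μ₀ ∧ μ₀ ≤ 1 ∧ μ₀ * ν ≤ 1 ∧ 0 ≤ k ∧ 0 ≤ D₁ ∧ 0 ≤ D₂ ∧ 0 ≤ D₃ ∧
    ∀ (μ σ Γ Z : ℝ) (e V S : ℕ → ℝ), 0 < μ → μ < μ₀ → 0 ≤ σ → 0 ≤ Γ → 0 ≤ Z →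
      (∀ i, 0 ≤ e i) → (∀ i, 0 ≤ V i) →
      (∀ i, S i ≤ 3 * b * (e i + V i + Γ) + σ) →
      (∀ i, e (i + 1) ≤ (1 - μ * ν / 2) * e i + c₁ * μ * (V i + Γ) + 2 * μ ^ 2 * S i) →
      (∀ i, V (i + 1) ≤ r * V i + c₂ * (3 * Γ + μ ^ 2 * (S i + V i + e i + Z))) →
      ∀ i, e i ≤ (1 - μ * ν / 4) ^ i * (e 0 + k * V 0)
        + (D₁ * μ * σ + D₂ * Γ + D₃ * μ ^ 2 * Z) := by
  have hr' : 0 < 1 - r := by linarith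
  -- `c₃` and `c₄` are the coefficients after the bound on `S` is substituted. The weight `k` is
  -- chosen so that half of the contraction of `V` pays for its feedback `c₄ μ V` into `e`.
  set c₃ := c₂ * (3 + 3 * b) with hc₃
  set c₄ := c₁ + 6 * b with hc₄
  set k := 2 * c₄ / (1 - r) with hk
  have hc₃₀ : 0 ≤ c₃ := by positivity
  have hc₄₀ : 0 ≤ c₄ := by positivity
  have hk₀ : 0 ≤ k := by positivity
  have hkr : k * (1 - r) = 2 * c₄ := by rw [hk]; field_simp
  obtain ⟨μ₀, hμ₀, hm₁, hm₂, hm₃, hm₄, hm₅, hm₆⟩ : ∃ μ₀ : ℝ, 0 < μ₀ ∧ μ₀ ≤ 1 ∧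
      μ₀ * ν ≤ 1 - r ∧ 6 * b * μ₀ ≤ ν / 8 ∧ k * c₃ * μ₀ ≤ ν / 8 ∧ c₃ * μ₀ ≤ (1 - r) / 4 ∧
      μ₀ * ν ≤ 1 := by
    -- `T` adds up the reciprocals of all upper bounds required of `μ₀`, so its inverse meets each
    -- of them.
    set T := 1 + ν / (1 - r) + 48 * b / ν + 8 * k * c₃ / ν + 4 * c₃ / (1 - r) + ν with hT
    have t₁ : 0 ≤ ν / (1 - r) := by positivity
    have t₂ : 0 ≤ 48 * b / ν := by positivity
    have t₃ : 0 ≤ 8 * k * c₃ / ν := by positivity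
    have t₄ : 0 ≤ 4 * c₃ / (1 - r) := by positivity
    have hT₀ : 0 < T := by positivity
    refine ⟨T⁻¹, inv_pos.2 hT₀, inv_le_one_of_one_le₀ (by linarith), ?_, ?_, ?_, ?_, ?_⟩
    · rw [inv_mul_le_iff₀ hT₀, ← div_le_iff₀ hr']; linarith
    · rw [mul_inv_le_iff₀ hT₀]
      have : 48 * b / ν ≤ T := by linarith
      rw [div_le_iff₀ hν] at this
      linarith
    · rw [mul_inv_le_iff₀ hT₀]
      have : 8 * k * c₃ / ν ≤ T := by linarith
      rw [div_le_iff₀ hν] at this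
      linarith
    · rw [mul_inv_le_iff₀ hT₀]
      have : 4 * c₃ / (1 - r) ≤ T := by linarith
      rw [div_le_iff₀ hr'] at this
      linarith
    · rw [inv_mul_le_iff₀ hT₀]; linarith
  refine ⟨μ₀, k, 4 / ν * (2 + k * c₃), 4 / ν * (c₄ + k * c₃), 4 / ν * (k * c₃), hμ₀, hm₁, hm₆, hk₀,
    by positivity, by positivity, by positivity, ?_⟩
  intro μ σ Γ Z e V S hμ hμμ₀ hσ hΓ hZ he hV hS hee hVV
  have n₁ : μ ≤ 1 := by linarith
  have n₂ : μ * ν ≤ 1 - r := (mul_le_mul_of_nonneg_right hμμ₀.le hν.le).trans hm₂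
  have n₃ : 6 * b * μ ≤ ν / 8 := (mul_le_mul_of_nonneg_left hμμ₀.le (by positivity)).trans hm₃
  have n₄ : k * c₃ * μ ≤ ν / 8 := (mul_le_mul_of_nonneg_left hμμ₀.le (by positivity)).trans hm₄
  have n₅ : c₃ * μ ≤ (1 - r) / 4 := (mul_le_mul_of_nonneg_left hμμ₀.le (by positivity)).trans hm₅
  have n₆ : μ * ν ≤ 1 := (mul_le_mul_of_nonneg_right hμμ₀.le hν.le).trans hm₆
  have n₇ : μ ^ 2 ≤ μ := by nlinarith
  have n₈ : μ ^ 2 ≤ 1 := by linarith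
  have hρ₀ : 0 ≤ 1 - μ * ν / 4 := by linarith
  -- Lyapunov function: the factor `μ` on `V` scales the order-one privacy forcing of `V` down to
  -- order `μ`, which the contraction gap `μν/4` can absorb.
  have hstep : ∀ i, e (i + 1) + k * μ * V (i + 1) ≤ (1 - μ * ν / 4) * (e i + k * μ * V i)
      + μ * ((c₄ + k * c₃) * Γ + (2 + k * c₃) * μ * σ + k * c₃ * μ ^ 2 * Z) := by
    intro i
    have he' : e (i + 1) ≤ (1 - μ * ν / 2 + 6 * b * μ ^ 2) * e i + c₄ * μ * (V i + Γ)
        + 2 * μ ^ 2 * σ := by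
      have h₁ : 2 * μ ^ 2 * S i ≤ 2 * μ ^ 2 * (3 * b * (e i + V i + Γ) + σ) :=
        mul_le_mul_of_nonneg_left (hS i) (by positivity)
      have h₂ : 6 * b * (V i + Γ) * μ ^ 2 ≤ 6 * b * (V i + Γ) * μ :=
        mul_le_mul_of_nonneg_left n₇ (mul_nonneg (by positivity) (add_nonneg (hV i) hΓ))
      rw [hc₄]
      linarith [hee i]
    have hV' : V (i + 1) ≤ (r + c₃ * μ ^ 2) * V i + c₃ * μ ^ 2 * e i + c₃ * Γ
        + c₃ * μ ^ 2 * (σ + Z) := by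
      have h₁ : c₂ * (μ ^ 2 * S i) ≤ c₂ * (μ ^ 2 * (3 * b * (e i + V i + Γ) + σ)) :=
        mul_le_mul_of_nonneg_left (mul_le_mul_of_nonneg_left (hS i) (by positivity)) hc₂
      have h₂ : c₂ * b * Γ * μ ^ 2 ≤ c₂ * b * Γ * 1 :=
        mul_le_mul_of_nonneg_left n₈ (by positivity)
      have h₃ : 0 ≤ c₂ * μ ^ 2 * V i := mul_nonneg (by positivity) (hV i)
      have h₄ : 0 ≤ c₂ * μ ^ 2 * e i := mul_nonneg (by positivity) (he i)
      have h₅ : 0 ≤ c₂ * μ ^ 2 * (2 + 3 * b) * (σ + Z) := by positivity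
      rw [hc₃]
      linarith [hVV i]
    have hV'' := mul_le_mul_of_nonneg_left hV' (mul_nonneg hk₀ hμ.le)
    have he₁ : (6 * b * μ ^ 2 + k * μ * (c₃ * μ ^ 2)) * e i ≤ μ * ν / 4 * e i := by
      refine mul_le_mul_of_nonneg_right ?_ (he i)
      have h₁ := mul_le_mul_of_nonneg_left n₃ hμ.le
      have h₂ := mul_le_mul_of_nonneg_left n₄ (sq_nonneg μ)
      have h₃ := mul_le_mul_of_nonneg_right n₇ (by positivity : 0 ≤ ν / 8)
      linarith
    have hV₁ : (c₄ * μ + k * μ * (r + c₃ * μ ^ 2)) * V i ≤ (1 - μ * ν / 4) * (k * μ) * V i := by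
      refine mul_le_mul_of_nonneg_right ?_ (hV i)
      have h₁ : c₃ * μ ^ 2 ≤ c₃ * μ := mul_le_mul_of_nonneg_left n₇ hc₃₀
      have h₂ := mul_le_mul_of_nonneg_left (by linarith :
        (1 - r) / 2 + (r + c₃ * μ ^ 2) ≤ 1 - μ * ν / 4) (mul_nonneg hk₀ hμ.le)
      have h₃ : c₄ * μ = k * μ * ((1 - r) / 2) := by linear_combination - μ / 2 * hkr
      linarith
    have hσ₁ : k * c₃ * σ * μ * μ ^ 2 ≤ k * c₃ * σ * μ * μ :=
      mul_le_mul_of_nonneg_left n₇ (by positivity)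
    linarith
  intro i
  have hgeo := le_geometric_of_le_mul_add (L := fun i => e i + k * μ * V i)
    (ρ := 1 - μ * ν / 4)
    (B := 4 / ν * ((c₄ + k * c₃) * Γ + (2 + k * c₃) * μ * σ + k * c₃ * μ ^ 2 * Z)) hρ₀
    (fun i => by
      refine (hstep i).trans (le_of_eq ?_)
      field_simp
      ring) (by positivity) i
  -- Dropping `μ ≤ 1` from the initial value makes the transient constant independent of `μ`.
  have hk₁ : k * μ * V 0 ≤ k * V 0 :=
    mul_le_mul_of_nonneg_right (mul_le_of_le_one_right hk₀ n₁) (hV 0)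
  have hp : (1 - μ * ν / 4) ^ i * (e 0 + k * μ * V 0) ≤ (1 - μ * ν / 4) ^ i * (e 0 + k * V 0) :=
    mul_le_mul_of_nonneg_left (by linarith) (pow_nonneg hρ₀ i)
  have hn := mul_nonneg (mul_nonneg hk₀ hμ.le) (hV i)
  linarith

end Recursion

/-! ### Pathwise inequalities for one iteration. -/

section Step

namespace NetCentroid

variable {M P : ℕ}

/-- Young's inequality with weight `τ` on `a, b` and weight one on `b, c`. The product of `a` and
`c` is kept exact because its expectation will vanish when `c` is the gradient noise. -/
theorem norm_add_add_sq_le {a b c : Param M} {τ : ℝ} (hτ : 0 < τ) :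
    ‖a + b + c‖ ^ 2 ≤ (1 + τ) * ‖a‖ ^ 2 + (2 + 1 / τ) * ‖b‖ ^ 2 + 2 * ‖c‖ ^ 2
      + 2 * inner ℝ a c := by
  have h₁ : 2 * inner ℝ a b ≤ τ * ‖a‖ ^ 2 + 1 / τ * ‖b‖ ^ 2 := by
    have h := real_inner_le_norm a b
    have h' : τ * ‖a‖ ^ 2 + 1 / τ * ‖b‖ ^ 2 - 2 * (‖a‖ * ‖b‖) = (τ * ‖a‖ - ‖b‖) ^ 2 / τ := by
      field_simp
      ring
    have : 0 ≤ (τ * ‖a‖ - ‖b‖) ^ 2 / τ := by positivity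
    linarith
  have h₂ : 2 * inner ℝ b c ≤ ‖b‖ ^ 2 + ‖c‖ ^ 2 := by
    have h := real_inner_le_norm b c
    linarith [two_mul_le_add_sq ‖b‖ ‖c‖]
  rw [norm_add_sq_real, norm_add_sq_real, inner_add_left]
  linarith

/-- The perturbation `∑ₘ aₘₚ gₘₚ` that agent `p` receives. -/
def linkNoise (a : Matrix (Fin P) (Fin P) ℝ) (g : Fin P → Fin P → Param M) (p : Fin P) :
    Param M :=
  ∑ m, a m p • g m p

theorem combine_eq (a : Matrix (Fin P) (Fin P) ℝ) (y : Fin P → Param M)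
    (g : Fin P → Fin P → Param M) : combine a y g = mix a y + linkNoise a g := by
  ext1 p
  simp [combine, mix_apply, linkNoise, smul_add, Finset.sum_add_distrib]

/-- Identifies the graph-homomorphic cancellation with vanishing of the weighted average of the
received noise. -/
theorem avg_linkNoise (a : Matrix (Fin P) (Fin P) ℝ) (q : Fin P → ℝ)
    (g : Fin P → Fin P → Param M) :
    avg q (linkNoise a g) = ∑ p, ∑ m, (q p * a m p) • g m p := by
  simp [avg_apply, linkNoise, Finset.smul_sum, smul_smul]

theorem pi_norm_sq_le_sum {E : Type*} [SeminormedAddCommGroup E] (x : Fin P → E) :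
    ‖x‖ ^ 2 ≤ ∑ p, ‖x p‖ ^ 2 := by
  have h : ‖x‖ ≤ √(∑ p, ‖x p‖ ^ 2) :=
    (pi_norm_le_iff_of_nonneg (Real.sqrt_nonneg _)).2 fun p => Real.le_sqrt_of_sq_le
      (Finset.single_le_sum (f := fun p => ‖x p‖ ^ 2) (fun _ _ => sq_nonneg _)
        (Finset.mem_univ p))
  calc ‖x‖ ^ 2 ≤ √(∑ p, ‖x p‖ ^ 2) ^ 2 := pow_le_pow_left₀ (norm_nonneg _) h 2
    _ = _ := Real.sq_sqrt (Finset.sum_nonneg fun _ _ => sq_nonneg _)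

theorem norm_linkNoise_sq_le {a : Matrix (Fin P) (Fin P) ℝ}
    (ha : a ∈ Matrix.colStochastic ℝ (Fin P)) (g : Fin P → Fin P → Param M) :
    ‖linkNoise a g‖ ^ 2 ≤ ∑ p, ∑ m, a m p * ‖g m p‖ ^ 2 := by
  refine (pi_norm_sq_le_sum _).trans (Finset.sum_le_sum fun p _ => ?_)
  have h₁ : ‖linkNoise a g p‖ ≤ ∑ m, a m p * ‖g m p‖ :=
    norm_sum_le_of_le _ fun m _ => by
      rw [norm_smul, Real.norm_of_nonneg (Matrix.nonneg_of_mem_colStochastic ha)]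
  exact (pow_le_pow_left₀ (norm_nonneg _) h₁ 2).trans (Real.pow_arith_mean_le_arith_mean_pow _ _ _
    (fun m _ => Matrix.nonneg_of_mem_colStochastic ha) (Matrix.sum_col_of_mem_colStochastic ha p)
    (fun m _ => norm_nonneg _) 2)

variable {ν δ ξ μ : ℝ} {q : Fin P → ℝ} {wo : Param M} {F : Fin P → Param M → Param M}
  {A : Fin 3 → Matrix (Fin P) (Fin P) ℝ}

theorem avg_step (hA : CombinationPolicy A q) (W η₀ η₁ η₂ H : Fin P → Param M)
    (h₀ : avg q η₀ = 0) (h₁ : avg q η₁ = 0) (h₂ : avg q η₂ = 0) :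
    avg q (mix (A 2) (mix (A 0) (mix (A 1) W + η₁) + η₀ - μ • H) + η₂)
      = avg q W - μ • avg q H := by
  rw [map_add, h₂, add_zero, avg_mix (hA.perron 2), map_sub, map_add, h₀, add_zero,
    avg_mix (hA.perron 0), map_add, h₁, add_zero, avg_mix (hA.perron 1), map_smul]

/-- Mixing fixes constant vectors, so only the deviations and the added noise separate `φ` from the
centroid. -/
theorem norm_mix_add_sub_avg_le {a : Matrix (Fin P) (Fin P) ℝ}
    (ha : a ∈ Matrix.colStochastic ℝ (Fin P)) (W η : Fin P → Param M) (p : Fin P) :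
    ‖(mix a W + η) p - avg q W‖ ≤ ‖dev q W‖ + ‖η‖ := by
  have h : (mix a W + η) p - avg q W = mix a (dev q W) p + η p := by
    rw [dev_eq, map_sub, mix_const ha]
    simp only [Pi.add_apply, Pi.sub_apply]
    abel
  rw [h]
  exact (norm_add_le _ _).trans (add_le_add
    ((norm_le_pi_norm _ p).trans (norm_mix_le ha _)) (norm_le_pi_norm η p))

/-- One step of the algorithm, seen from the centroid. -/
theorem norm_sq_sub_avg_step_le (hA : CombinationPolicy A q) (hF : GradientFields ν δ ξ q wo F)
    (hν : 0 < ν) (hδ : 0 ≤ δ) (hμ : 0 < μ) (hμν : μ * ν ≤ 1) (hμδ : μ * δ ^ 2 ≤ ν)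
    (W η₀ η₁ η₂ s : Fin P → Param M)
    (h₀ : avg q η₀ = 0) (h₁ : avg q η₁ = 0) (h₂ : avg q η₂ = 0) :
    ‖wo - avg q (mix (A 2) (mix (A 0) (mix (A 1) W + η₁) + η₀
        - μ • fun p => s p + F p ((mix (A 1) W + η₁) p)) + η₂)‖ ^ 2
      ≤ (1 - μ * ν / 2) * ‖wo - avg q W‖ ^ 2 + 8 * δ ^ 2 / ν * μ * (‖dev q W‖ ^ 2 + ‖η₁‖ ^ 2)
        + 2 * μ ^ 2 * ‖s‖ ^ 2
        + 2 * μ * inner ℝ (wo - avg q W + μ • ∑ p, q p • F p (avg q W)) (avg q s) := by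
  have hq₀ := fun p => (hA.perron_pos p).le
  rw [avg_step hA W η₀ η₁ η₂ _ h₀ h₁ h₂]
  set φ := mix (A 1) W + η₁ with hφ
  set v := avg q (fun p => F p (φ p) - F p (avg q W)) with hv
  -- Gradient step at the centroid, plus bias from evaluating at `φ`, plus averaged gradient noise.
  have hsplit : wo - (avg q W - μ • avg q (fun p => s p + F p (φ p)))
      = (wo - avg q W + μ • ∑ p, q p • F p (avg q W)) + μ • v + μ • avg q s := by
    have e₁ : avg q (fun p => s p + F p (φ p)) = avg q s + avg q (fun p => F p (φ p)) :=
      map_add (avg q) s _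
    have e₂ : v = avg q (fun p => F p (φ p)) - ∑ p, q p • F p (avg q W) :=
      map_sub (avg q) (fun p => F p (φ p)) _
    rw [e₁, e₂, smul_sub, smul_add]
    abel
  have hvn : ‖v‖ ^ 2 ≤ 2 * δ ^ 2 * (‖dev q W‖ ^ 2 + ‖η₁‖ ^ 2) := by
    have h : ‖v‖ ≤ δ * (‖dev q W‖ + ‖η₁‖) := by
      refine (norm_avg_le hq₀ hA.perron_sum _).trans
        ((pi_norm_le_iff_of_nonneg (by positivity)).2 fun p => ?_)
      exact (hF.lipschitz p _ _).trans (mul_le_mul_of_nonneg_left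
        (norm_mix_add_sub_avg_le (hA.left_stochastic 1) W η₁ p) hδ)
    have h' := pow_le_pow_left₀ (norm_nonneg _) h 2
    have h'' := mul_le_mul_of_nonneg_left (two_mul_le_add_sq ‖dev q W‖ ‖η₁‖) (sq_nonneg δ)
    linarith
  have hs : ‖avg q s‖ ^ 2 ≤ ‖s‖ ^ 2 :=
    pow_le_pow_left₀ (norm_nonneg _) (norm_avg_le hq₀ hA.perron_sum s) 2
  have ha := hF.norm_sq_step_le hq₀ hA.perron_sum hμ.le hμδ (avg q W)
  set a := wo - avg q W + μ • ∑ p, q p • F p (avg q W) with ha_def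
  -- With `τ = μν/2`, `(1 + τ)(1 - μν) ≤ 1 - μν/2`, while `1/τ` cancels one factor `μ` of the
  -- squared bias.
  have hmain := norm_add_add_sq_le (a := a) (b := μ • v) (c := μ • avg q s)
    (half_pos (mul_pos hμ hν))
  rw [hsplit]
  rw [norm_smul, norm_smul, mul_pow, mul_pow, Real.norm_of_nonneg hμ.le,
    real_inner_smul_right] at hmain
  have t₁ : (1 + μ * ν / 2) * ‖a‖ ^ 2 ≤ (1 - μ * ν / 2) * ‖wo - avg q W‖ ^ 2 := by
    calc (1 + μ * ν / 2) * ‖a‖ ^ 2 ≤ (1 + μ * ν / 2) * ((1 - μ * ν) * ‖wo - avg q W‖ ^ 2) := by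
          gcongr
      _ ≤ (1 - μ * ν / 2) * ‖wo - avg q W‖ ^ 2 := by
          have : 0 ≤ (μ * ν) ^ 2 * ‖wo - avg q W‖ ^ 2 := by positivity
          linarith
  have t₂ : (2 + 1 / (μ * ν / 2)) * (μ ^ 2 * ‖v‖ ^ 2)
      ≤ 8 * δ ^ 2 / ν * μ * (‖dev q W‖ ^ 2 + ‖η₁‖ ^ 2) := by
    have h : (2 + 1 / (μ * ν / 2)) * μ ^ 2 ≤ 4 / ν * μ := by
      have : (2 + 1 / (μ * ν / 2)) * μ ^ 2 = (2 * (μ * ν) + 2) / ν * μ := by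
        field_simp
      rw [this]
      gcongr
      linarith
    calc (2 + 1 / (μ * ν / 2)) * (μ ^ 2 * ‖v‖ ^ 2)
        = ((2 + 1 / (μ * ν / 2)) * μ ^ 2) * ‖v‖ ^ 2 := by ring
      _ ≤ (4 / ν * μ) * (2 * δ ^ 2 * (‖dev q W‖ ^ 2 + ‖η₁‖ ^ 2)) := by gcongr
      _ = _ := by ring
  have t₃ : 2 * (μ ^ 2 * ‖avg q s‖ ^ 2) ≤ 2 * μ ^ 2 * ‖s‖ ^ 2 := by
    rw [mul_assoc]
    gcongr
  linarith

/-- Convexity of the square at `r x + (1 - r) (y / (1 - r))`; the rate `r` survives squaring. -/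
theorem add_sq_le_of_contraction {r x y : ℝ} (hr₀ : 0 < r) (hr : r < 1) :
    (r * x + y) ^ 2 ≤ r * x ^ 2 + y ^ 2 / (1 - r) := by
  have h : r * x ^ 2 + y ^ 2 / (1 - r) - (r * x + y) ^ 2
      = r * ((1 - r) * x - y) ^ 2 / (1 - r) := by
    have : 1 - r ≠ 0 := by linarith
    field_simp
    ring
  have h' : 0 ≤ r * ((1 - r) * x - y) ^ 2 / (1 - r) :=
    div_nonneg (by positivity) (by linarith)
  linarith

/-- One step of the algorithm, seen from the deviations from the centroid. -/
theorem dev_step_sq_le (hA : CombinationPolicy A q) (hF : GradientFields ν δ ξ q wo F)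
    (hδ : 0 ≤ δ) (hμ : 0 < μ) (hμ₁ : μ ≤ 1) {N : (Fin P → Param M) → ℝ} {r C : ℝ}
    (hr₀ : 0 < r) (hr : r < 1) (hN_add : ∀ x y, N (x + y) ≤ N x + N y) (hN_ge : ∀ x, ‖x‖ ≤ N x)
    (hN_le : ∀ x, N x ≤ C * ‖x‖) (hC : 0 ≤ C)
    (hN_mix : ∀ x, avg q x = 0 → N (mix (A 1 * A 0 * A 2) x) ≤ r * N x)
    (W η₀ η₁ η₂ s : Fin P → Param M) :
    N (dev q (mix (A 2) (mix (A 0) (mix (A 1) W + η₁) + η₀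
        - μ • fun p => s p + F p ((mix (A 1) W + η₁) p)) + η₂)) ^ 2
      ≤ r * N (dev q W) ^ 2 + 32 * C ^ 2 * (1 + δ ^ 2) / (1 - r) *
        (‖η₀‖ ^ 2 + ‖η₁‖ ^ 2 + ‖η₂‖ ^ 2
          + μ ^ 2 * (‖s‖ ^ 2 + N (dev q W) ^ 2 + ‖wo - avg q W‖ ^ 2 + ξ ^ 2)) := by
  have hst := hA.left_stochastic
  have hq₀ := fun p => (hA.perron_pos p).le
  set H : Fin P → Param M := fun p => s p + F p ((mix (A 1) W + η₁) p) with hH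
  -- By linearity, everything except the mixed old state is collected in one perturbation.
  set ρ := mix (A 2) (mix (A 0) η₁ + η₀ - μ • H) + η₂ with hρ
  have hsplit : mix (A 2) (mix (A 0) (mix (A 1) W + η₁) + η₀ - μ • H) + η₂
      = mix (A 1 * A 0 * A 2) W + ρ := by
    rw [hρ, mix_mul, mix_mul]
    simp only [map_add, map_sub]
    abel
  have hHn : ‖H‖ ≤ ‖s‖ + δ * (‖wo - avg q W‖ + (‖dev q W‖ + ‖η₁‖) + |ξ|) := by
    refine (pi_norm_le_iff_of_nonneg (by positivity)).2 fun p => ?_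
    refine (norm_add_le _ _).trans (add_le_add (norm_le_pi_norm s p)
      ((hF.norm_le p _).trans (mul_le_mul_of_nonneg_left ?_ hδ)))
    have h := norm_sub_le_norm_sub_add_norm_sub wo (avg q W) ((mix (A 1) W + η₁) p)
    rw [norm_sub_rev (avg q W)] at h
    linarith [norm_mix_add_sub_avg_le (q := q) (hst 1) W η₁ p, le_abs_self ξ]
  have hρn : ‖ρ‖ ≤ ‖η₀‖ + ‖η₁‖ + ‖η₂‖ + μ * ‖H‖ := by
    have h₁ := norm_add_le (mix (A 2) (mix (A 0) η₁ + η₀ - μ • H)) η₂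
    have h₂ := norm_mix_le (hst 2) (mix (A 0) η₁ + η₀ - μ • H)
    have h₃ := norm_sub_le (mix (A 0) η₁ + η₀) (μ • H)
    have h₄ := norm_add_le (mix (A 0) η₁) η₀
    have h₅ := norm_mix_le (hst 0) η₁
    rw [norm_smul, Real.norm_of_nonneg hμ.le] at h₃
    linarith
  have hρn₂ : ‖ρ‖ ^ 2 ≤ 8 * (1 + δ ^ 2) * (‖η₀‖ ^ 2 + ‖η₁‖ ^ 2 + ‖η₂‖ ^ 2
      + μ ^ 2 * (‖s‖ ^ 2 + N (dev q W) ^ 2 + ‖wo - avg q W‖ ^ 2 + ξ ^ 2)) := by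
    have hμ₂ : μ ^ 2 ≤ 1 := pow_le_one₀ hμ.le hμ₁
    have hd : ‖dev q W‖ ^ 2 ≤ N (dev q W) ^ 2 := pow_le_pow_left₀ (norm_nonneg _) (hN_ge _) 2
    have h₁ : ‖ρ‖ ≤ ‖η₀‖ + ‖η₁‖ + ‖η₂‖ + μ * ‖s‖ + μ * δ * ‖wo - avg q W‖
        + μ * δ * ‖dev q W‖ + μ * δ * ‖η₁‖ + μ * δ * |ξ| := by
      have := mul_le_mul_of_nonneg_left hHn hμ.le
      linarith
    -- Cauchy–Schwarz for the eight summands gives the factor 8; with the later `(2C)²` it produces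
    -- `32 C²`.
    have hcs : ∀ a₁ a₂ a₃ a₄ a₅ a₆ a₇ a₈ : ℝ,
        (a₁ + a₂ + a₃ + a₄ + a₅ + a₆ + a₇ + a₈) ^ 2
          ≤ 8 * (a₁ ^ 2 + a₂ ^ 2 + a₃ ^ 2 + a₄ ^ 2 + a₅ ^ 2 + a₆ ^ 2 + a₇ ^ 2 + a₈ ^ 2) := by
      intro a₁ a₂ a₃ a₄ a₅ a₆ a₇ a₈
      have h := sq_sum_le_card_mul_sum_sq (s := Finset.univ)
        (f := ![a₁, a₂, a₃, a₄, a₅, a₆, a₇, a₈])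
      simpa [Fin.sum_univ_succ, add_assoc] using h
    have h₂ := (pow_le_pow_left₀ (norm_nonneg _) h₁ 2).trans (hcs _ _ _ _ _ _ _ _)
    simp only [mul_pow, sq_abs] at h₂
    have g₁ : μ ^ 2 * (δ ^ 2 * ‖η₁‖ ^ 2) ≤ 1 * (δ ^ 2 * ‖η₁‖ ^ 2) := by gcongr
    have g₂ : (1 + δ ^ 2) * μ ^ 2 * ‖dev q W‖ ^ 2 ≤ (1 + δ ^ 2) * μ ^ 2 * N (dev q W) ^ 2 := by
      gcongr
    have g₃ : 0 ≤ δ ^ 2 * (‖η₀‖ ^ 2 + ‖η₂‖ ^ 2 + μ ^ 2 * ‖s‖ ^ 2) := by positivity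
    have g₄ : 0 ≤ μ ^ 2 * (‖dev q W‖ ^ 2 + ‖wo - avg q W‖ ^ 2 + ξ ^ 2) := by positivity
    linarith
  have hNle : N (dev q (mix (A 1 * A 0 * A 2) W + ρ)) ≤ r * N (dev q W) + 2 * C * ‖ρ‖ := by
    have hmul : A 1 * A 0 * A 2 ∈ Matrix.colStochastic ℝ (Fin P) :=
      mul_mem (mul_mem (hst 1) (hst 0)) (hst 2)
    have hperron : (A 1 * A 0 * A 2).mulVec q = q := by
      rw [← Matrix.mulVec_mulVec, hA.perron 2, ← Matrix.mulVec_mulVec, hA.perron 0, hA.perron 1]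
    rw [map_add, dev_mix hmul hperron]
    have h₁ := hN_mix (dev q W) (avg_dev hA.perron_sum W)
    have h₂ := hN_le (dev q ρ)
    have h₃ := mul_le_mul_of_nonneg_left (norm_dev_le hq₀ hA.perron_sum ρ) hC
    linarith [hN_add (mix (A 1 * A 0 * A 2) (dev q W)) (dev q ρ)]
  rw [hsplit]
  have hN₀ : ∀ x, 0 ≤ N x := fun x => (norm_nonneg x).trans (hN_ge x)
  refine (pow_le_pow_left₀ (hN₀ _) hNle 2).trans
    ((add_sq_le_of_contraction hr₀ hr).trans (add_le_add_right ?_ _))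
  have hr' : 0 < 1 - r := by linarith
  rw [div_mul_eq_mul_div]
  refine div_le_div_of_nonneg_right ?_ hr'.le
  have := mul_le_mul_of_nonneg_left hρn₂ (by positivity : 0 ≤ 4 * C ^ 2)
  linarith

theorem norm_sq_sub_mix_le {a : Matrix (Fin P) (Fin P) ℝ}
    (ha : a ∈ Matrix.colStochastic ℝ (Fin P)) (wo : Param M) (W η : Fin P → Param M)
    (p : Fin P) :
    ‖wo - (mix a W + η) p‖ ^ 2 ≤ 3 * (‖wo - avg q W‖ ^ 2 + ‖dev q W‖ ^ 2 + ‖η‖ ^ 2) := by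
  have h := norm_sub_le_norm_sub_add_norm_sub wo (avg q W) ((mix a W + η) p)
  rw [norm_sub_rev (avg q W)] at h
  have h₁ := h.trans (add_le_add_right (norm_mix_add_sub_avg_le (q := q) ha W η p) _)
  have h₂ := pow_le_pow_left₀ (norm_nonneg _) h₁ 2
  linarith [two_mul_le_add_sq ‖wo - avg q W‖ ‖dev q W‖, two_mul_le_add_sq ‖wo - avg q W‖ ‖η‖,
    two_mul_le_add_sq ‖dev q W‖ ‖η‖]

end NetCentroid

end Step

/-! ### Integrability and the mean-square recursions. -/

section Probability

namespace NetCentroid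

theorem memLp_linearMap {Ω : Type u} [MeasurableSpace Ω] {ℙ : Measure Ω} {E F : Type*}
    [NormedAddCommGroup E] [NormedSpace ℝ E] [FiniteDimensional ℝ E] [NormedAddCommGroup F]
    [NormedSpace ℝ F] (L : E →ₗ[ℝ] F) {f : Ω → E} (hf : MemLp f 2 ℙ) :
    MemLp (fun ω => L (f ω)) 2 ℙ :=
  (LinearMap.toContinuousLinearMap L).comp_memLp' hf

/-- A past-measurable factor can be pulled out of the conditional expectation of the inner product.
-/
theorem integral_inner_eq_zero_of_condExp_eq_zero {Ω : Type u} {m m₀ : MeasurableSpace Ω}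
    {ℙ : Measure Ω} [IsProbabilityMeasure ℙ] (hm : m ≤ m₀) {M : ℕ} {a s : Ω → Param M}
    (ha : Measurable[m] a) (ha₂ : MemLp a 2 ℙ) (hs₂ : MemLp s 2 ℙ) (hs : ℙ[s | m] =ᵐ[ℙ] 0) :
    Integrable (fun ω => inner ℝ (a ω) (s ω)) ℙ ∧ ∫ ω, inner ℝ (a ω) (s ω) ∂ℙ = 0 := by
  have hint : Integrable (fun ω => inner ℝ (a ω) (s ω)) ℙ := by
    refine (ha₂.integrable_norm_pow two_ne_zero |>.add
      (hs₂.integrable_norm_pow two_ne_zero)).mono'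
      (ha₂.aestronglyMeasurable.inner hs₂.aestronglyMeasurable) (ae_of_all _ fun ω => ?_)
    have h₁ := abs_real_inner_le_norm (a ω) (s ω)
    have h₂ := two_mul_le_add_sq ‖a ω‖ ‖s ω‖
    have h₃ := mul_nonneg (norm_nonneg (a ω)) (norm_nonneg (s ω))
    simp only [Real.norm_eq_abs, Pi.add_apply]
    linarith
  refine ⟨hint, ?_⟩
  have h := condExp_bilin_of_stronglyMeasurable_left (μ := ℙ) (innerSL ℝ)
    (Measurable.stronglyMeasurable ha) hint (hs₂.integrable one_le_two)
  rw [← integral_condExp hm]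
  refine integral_eq_zero_of_ae (h.trans ?_)
  filter_upwards [hs] with ω hω
  simp [hω]

theorem integrable_norm_sq {Ω : Type u} [MeasurableSpace Ω] {ℙ : Measure Ω} {E : Type*}
    [NormedAddCommGroup E] {f : Ω → E} (hf : MemLp f 2 ℙ) :
    Integrable (fun ω => ‖f ω‖ ^ 2) ℙ :=
  hf.integrable_norm_pow two_ne_zero

theorem memLp_mix {Ω : Type u} [MeasurableSpace Ω] {ℙ : Measure Ω} {M P : ℕ}
    (a : Matrix (Fin P) (Fin P) ℝ) {f : Ω → Fin P → Param M} (hf : MemLp f 2 ℙ) :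
    MemLp (fun ω => mix a (f ω)) 2 ℙ :=
  memLp_linearMap (mix a) hf

theorem memLp_avg {Ω : Type u} [MeasurableSpace Ω] {ℙ : Measure Ω} {M P : ℕ}
    (q : Fin P → ℝ) {f : Ω → Fin P → Param M} (hf : MemLp f 2 ℙ) :
    MemLp (fun ω => avg q (f ω)) 2 ℙ :=
  memLp_linearMap (avg q) hf

theorem memLp_dev {Ω : Type u} [MeasurableSpace Ω] {ℙ : Measure Ω} {M P : ℕ}
    (q : Fin P → ℝ) {f : Ω → Fin P → Param M} (hf : MemLp f 2 ℙ) :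
    MemLp (fun ω => dev q (f ω)) 2 ℙ :=
  memLp_linearMap (dev q) hf

theorem measurable_pastModels {Ω : Type u} {M P : ℕ} (W : ℕ → Fin P → Ω → Param M) (i : ℕ) :
    Measurable[pastModels W i] fun ω p => W i p ω := by
  refine @measurable_pi_lambda _ _ _ (pastModels W i) _ _ fun p => ?_
  rw [measurable_iff_comap_le]
  exact (le_iSup (fun p => MeasurableSpace.comap (W i p) inferInstance) p).trans
    (le_iSup (fun j : Fin (i + 1) => ⨆ p : Fin P, MeasurableSpace.comap (W j p) inferInstance)
      ⟨i, i.lt_succ_self⟩)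

variable {Ω : Type u} [MeasurableSpace Ω] {ℙ : Measure Ω} {M P : ℕ}
  {ν δ ξ μ : ℝ} {q : Fin P → ℝ} {wo : Param M} {F : Fin P → Param M → Param M}
  {A : Fin 3 → Matrix (Fin P) (Fin P) ℝ}

theorem GradientFields.continuous (hF : GradientFields ν δ ξ q wo F) (p : Fin P) :
    Continuous (F p) :=
  (LipschitzWith.of_dist_le_mul (K := δ.toNNReal) fun w₁ w₂ => by
    rw [dist_eq_norm, dist_eq_norm]
    exact (hF.lipschitz p w₂ w₁).trans
      (mul_le_mul_of_nonneg_right (Real.le_coe_toNNReal δ) (norm_nonneg _))).continuous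

theorem GradientFields.memLp [IsProbabilityMeasure ℙ] (hF : GradientFields ν δ ξ q wo F) (p : Fin P)
    {f : Ω → Param M} (hf : MemLp f 2 ℙ) : MemLp (fun ω => F p (f ω)) 2 ℙ := by
  have h : MemLp (fun ω => δ * (‖wo - f ω‖ + ξ)) 2 ℙ :=
    ((((memLp_const wo).sub hf).norm).add (memLp_const ξ)).const_mul δ
  exact h.mono' ((hF.continuous p).comp_aestronglyMeasurable hf.aestronglyMeasurable)
    (ae_of_all _ fun ω => hF.norm_le p (f ω))

/-- A process of models driven by combined privacy noises `η j` of zero weighted average and by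
gradient noise `s`. -/
structure NoisyDiffusion (ℙ : Measure Ω) (A : Fin 3 → Matrix (Fin P) (Fin P) ℝ) (q : Fin P → ℝ)
    (μ Γ : ℝ) (β σs : Fin P → ℝ) (wo : Param M) (F : Fin P → Param M → Param M)
    (W : ℕ → Fin P → Ω → Param M) (η : Fin 3 → ℕ → Ω → Fin P → Param M)
    (s : ℕ → Fin P → Ω → Param M) : Prop where
  measurable_zero : ∀ p, Measurable (W 0 p)
  memLp_zero : ∀ p, MemLp (W 0 p) 2 ℙ
  measurable_noise : ∀ j i, Measurable (η j i)
  memLp_noise : ∀ j i, MemLp (η j i) 2 ℙ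
  noise_le : ∀ j i, ∫ ω, ‖η j i ω‖ ^ 2 ∂ℙ ≤ Γ
  avg_noise : ∀ j i, ∀ᵐ ω ∂ℙ, avg q (η j i ω) = 0
  gradient_noise : GradientNoise ℙ β σs wo W
    (fun i p ω => (mix (A 1) (fun m => W i m ω) + η 1 i ω) p) s
  step_eq : ∀ i ω, (fun p => W (i + 1) p ω) =
    mix (A 2) (mix (A 0) (mix (A 1) (fun m => W i m ω) + η 1 i ω) + η 0 i ω
      - μ • fun p => s i p ω + F p ((mix (A 1) (fun m => W i m ω) + η 1 i ω) p)) + η 2 i ω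

namespace NoisyDiffusion

variable {Γ : ℝ} {β σs : Fin P → ℝ} {W : ℕ → Fin P → Ω → Param M}
  {η : Fin 3 → ℕ → Ω → Fin P → Param M} {s : ℕ → Fin P → Ω → Param M}

theorem measurable (h : NoisyDiffusion ℙ A q μ Γ β σs wo F W η s)
    (hF : GradientFields ν δ ξ q wo F) (i : ℕ) : Measurable fun ω p => W i p ω := by
  induction i with
  | zero => exact measurable_pi_lambda _ h.measurable_zero
  | succ i ih =>
    have hφ : Measurable fun ω => mix (A 1) (fun m => W i m ω) + η 1 i ω :=
      ((continuous_mix (A 1)).measurable.comp ih).add (h.measurable_noise 1 i)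
    have hH : Measurable fun ω p =>
        s i p ω + F p ((mix (A 1) (fun m => W i m ω) + η 1 i ω) p) :=
      measurable_pi_lambda _ fun p => (h.gradient_noise.measurable i p).add
        ((hF.continuous p).measurable.comp ((measurable_pi_apply p).comp hφ))
    have : (fun ω p => W (i + 1) p ω) = _ := funext fun ω => h.step_eq i ω
    rw [this]
    exact ((continuous_mix (A 2)).measurable.comp
      ((((continuous_mix (A 0)).measurable.comp hφ).add (h.measurable_noise 0 i)).sub
        (hH.const_smul μ))).add (h.measurable_noise 2 i)

theorem memLp [IsProbabilityMeasure ℙ] (h : NoisyDiffusion ℙ A q μ Γ β σs wo F W η s)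
    (hF : GradientFields ν δ ξ q wo F) (i : ℕ) : MemLp (fun ω p => W i p ω) 2 ℙ := by
  induction i with
  | zero => exact MemLp.of_eval h.memLp_zero
  | succ i ih =>
    have hφ : MemLp (fun ω => mix (A 1) (fun m => W i m ω) + η 1 i ω) 2 ℙ :=
      (memLp_mix (A 1) ih).add (h.memLp_noise 1 i)
    have hH : MemLp (fun ω p =>
        s i p ω + F p ((mix (A 1) (fun m => W i m ω) + η 1 i ω) p)) 2 ℙ :=
      MemLp.of_eval fun p => (h.gradient_noise.memLp i p).add (hF.memLp p (hφ.eval p))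
    have : (fun ω p => W (i + 1) p ω) = _ := funext fun ω => h.step_eq i ω
    rw [this]
    have hψ : MemLp (fun ω => mix (A 0) (mix (A 1) (fun m => W i m ω) + η 1 i ω) + η 0 i ω
        - μ • fun p => s i p ω + F p ((mix (A 1) (fun m => W i m ω) + η 1 i ω) p)) 2 ℙ :=
      ((memLp_mix (A 0) hφ).add (h.memLp_noise 0 i)).sub (hH.const_smul μ)
    exact (memLp_mix (A 2) hψ).add (h.memLp_noise 2 i)

theorem pastModels_le (h : NoisyDiffusion ℙ A q μ Γ β σs wo F W η s)
    (hF : GradientFields ν δ ξ q wo F) (i : ℕ) : pastModels W i ≤ ‹MeasurableSpace Ω› :=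
  iSup_le fun j => iSup_le fun p =>
    ((measurable_pi_apply p).comp (h.measurable hF j)).comap_le

theorem integrable_error [IsProbabilityMeasure ℙ] (h : NoisyDiffusion ℙ A q μ Γ β σs wo F W η s)
    (hF : GradientFields ν δ ξ q wo F) (i : ℕ) :
    Integrable (fun ω => ‖wo - avg q fun p => W i p ω‖ ^ 2) ℙ :=
  integrable_norm_sq ((memLp_const wo).sub (memLp_avg q (h.memLp hF i)))

theorem integrable_dev [IsProbabilityMeasure ℙ] (h : NoisyDiffusion ℙ A q μ Γ β σs wo F W η s)
    (hF : GradientFields ν δ ξ q wo F) (i : ℕ) :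
    Integrable (fun ω => ‖dev q fun p => W i p ω‖ ^ 2) ℙ :=
  integrable_norm_sq (memLp_dev q (h.memLp hF i))

theorem integrable_norm_dev [IsProbabilityMeasure ℙ] (h : NoisyDiffusion ℙ A q μ Γ β σs wo F W η s)
    (hF : GradientFields ν δ ξ q wo F) {N : (Fin P → Param M) → ℝ} {C : ℝ} (hN : Continuous N)
    (hN_ge : ∀ x, ‖x‖ ≤ N x) (hN_le : ∀ x, N x ≤ C * ‖x‖) (i : ℕ) :
    Integrable (fun ω => N (dev q fun p => W i p ω) ^ 2) ℙ := by
  have hd := memLp_dev q (h.memLp hF i)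
  refine ((integrable_norm_sq hd).const_mul (C ^ 2)).mono'
    ((hN.comp_aestronglyMeasurable hd.aestronglyMeasurable).pow 2) (ae_of_all _ fun ω => ?_)
  rw [Real.norm_of_nonneg (sq_nonneg _), ← mul_pow]
  exact pow_le_pow_left₀ ((norm_nonneg _).trans (hN_ge _)) (hN_le _) 2

theorem integrable_noise (h : NoisyDiffusion ℙ A q μ Γ β σs wo F W η s) (j : Fin 3) (i : ℕ) :
    Integrable (fun ω => ‖η j i ω‖ ^ 2) ℙ :=
  integrable_norm_sq (h.memLp_noise j i)

theorem integrable_gradient_noise (h : NoisyDiffusion ℙ A q μ Γ β σs wo F W η s) (i : ℕ) :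
    Integrable (fun ω => ‖fun p => s i p ω‖ ^ 2) ℙ :=
  integrable_norm_sq (MemLp.of_eval fun p => h.gradient_noise.memLp i p)

/-- Integrating removes the conditioning, and the error at `φ` splits into centroid error, deviation
and privacy noise. -/
theorem gradient_noise_le [IsProbabilityMeasure ℙ] (h : NoisyDiffusion ℙ A q μ Γ β σs wo F W η s)
    (hA : CombinationPolicy A q) (hF : GradientFields ν δ ξ q wo F) (i : ℕ) :
    ∫ ω, ‖fun p => s i p ω‖ ^ 2 ∂ℙ ≤ 3 * (∑ p, β p ^ 2)
      * (∫ ω, ‖wo - avg q fun p => W i p ω‖ ^ 2 ∂ℙ + ∫ ω, ‖dev q fun p => W i p ω‖ ^ 2 ∂ℙ + Γ)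
      + ∑ p, σs p ^ 2 := by
  have hφ : MemLp (fun ω => mix (A 1) (fun m => W i m ω) + η 1 i ω) 2 ℙ :=
    (memLp_mix (A 1) (h.memLp hF i)).add (h.memLp_noise 1 i)
  have hφi : ∀ p, Integrable
      (fun ω => ‖wo - (mix (A 1) (fun m => W i m ω) + η 1 i ω) p‖ ^ 2) ℙ := fun p =>
    integrable_norm_sq ((memLp_const wo).sub (hφ.eval p))
  have hsi : ∀ p, Integrable (fun ω => ‖s i p ω‖ ^ 2) ℙ := fun p =>
    integrable_norm_sq (h.gradient_noise.memLp i p)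
  have he := h.integrable_error hF i
  have hd := h.integrable_dev hF i
  have hη := h.integrable_noise 1 i
  have hp : ∀ p, ∫ ω, ‖s i p ω‖ ^ 2 ∂ℙ ≤ β p ^ 2 * (3 * (∫ ω, ‖wo - avg q fun p => W i p ω‖ ^ 2 ∂ℙ
      + ∫ ω, ‖dev q fun p => W i p ω‖ ^ 2 ∂ℙ + Γ)) + σs p ^ 2 := by
    intro p
    have hle : ∫ ω, ‖wo - (mix (A 1) (fun m => W i m ω) + η 1 i ω) p‖ ^ 2 ∂ℙ
        ≤ 3 * (∫ ω, ‖wo - avg q fun p => W i p ω‖ ^ 2 ∂ℙ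
          + ∫ ω, ‖dev q fun p => W i p ω‖ ^ 2 ∂ℙ + Γ) := by
      refine (integral_mono (hφi p) (((he.add hd).add hη).const_mul 3) fun ω =>
        norm_sq_sub_mix_le (q := q) (hA.left_stochastic 1) wo _ _ p).trans ?_
      rw [integral_const_mul, integral_add' (he.add hd) hη, integral_add' he hd]
      linarith [h.noise_le 1 i]
    have hm := h.pastModels_le hF i
    calc ∫ ω, ‖s i p ω‖ ^ 2 ∂ℙ
        = ∫ ω, (ℙ[fun ω => ‖s i p ω‖ ^ 2 | pastModels W i]) ω ∂ℙ := (integral_condExp hm).symm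
      _ ≤ ∫ ω, (ℙ[fun ω => β p ^ 2 * ‖wo - (mix (A 1) (fun m => W i m ω) + η 1 i ω) p‖ ^ 2
            + σs p ^ 2 | pastModels W i]) ω ∂ℙ :=
          integral_mono_ae integrable_condExp integrable_condExp
            (h.gradient_noise.second_moment i p)
      _ = β p ^ 2 * ∫ ω, ‖wo - (mix (A 1) (fun m => W i m ω) + η 1 i ω) p‖ ^ 2 ∂ℙ
            + σs p ^ 2 := by
          rw [integral_condExp hm, integral_add ((hφi p).const_mul _) (integrable_const _),
            integral_const_mul]
          simp
      _ ≤ _ := by gcongr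
  calc ∫ ω, ‖fun p => s i p ω‖ ^ 2 ∂ℙ ≤ ∫ ω, ∑ p, ‖s i p ω‖ ^ 2 ∂ℙ :=
        integral_mono (h.integrable_gradient_noise i) (integrable_finsetSum _ fun p _ => hsi p)
          fun ω => pi_norm_sq_le_sum _
    _ = ∑ p, ∫ ω, ‖s i p ω‖ ^ 2 ∂ℙ := integral_finsetSum _ fun p _ => hsi p
    _ ≤ _ := Finset.sum_le_sum fun p _ => hp p
    _ = _ := by
        rw [Finset.sum_add_distrib, ← Finset.sum_mul]
        ring

/-- The gradient step is taken at the centroid, a function of the past models. At `φ` orthogonality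
could fail, since `φ` contains current privacy noise that may be correlated with `s`. -/
theorem cross_term [IsProbabilityMeasure ℙ] (h : NoisyDiffusion ℙ A q μ Γ β σs wo F W η s)
    (hF : GradientFields ν δ ξ q wo F) (i : ℕ) :
    Integrable (fun ω => inner ℝ ((wo - avg q fun p => W i p ω)
      + μ • ∑ p, q p • F p (avg q fun p => W i p ω)) (avg q fun p => s i p ω)) ℙ ∧
    ∫ ω, inner ℝ ((wo - avg q fun p => W i p ω)
      + μ • ∑ p, q p • F p (avg q fun p => W i p ω)) (avg q fun p => s i p ω) ∂ℙ = 0 := by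
  have hc : Continuous fun x : Fin P → Param M =>
      wo - avg q x + μ • ∑ p, q p • F p (avg q x) :=
    (continuous_const.sub (continuous_avg q)).add ((continuous_finsetSum _ fun p _ =>
      ((hF.continuous p).comp (continuous_avg q)).const_smul (q p)).const_smul μ)
  have hw := memLp_avg q (h.memLp hF i)
  have ha₂ : MemLp (fun ω => (wo - avg q fun p => W i p ω)
      + μ • ∑ p, q p • F p (avg q fun p => W i p ω)) 2 ℙ :=
    ((memLp_const wo).sub hw).add ((memLp_finsetSum _ fun p _ =>
      (hF.memLp p hw).const_smul (q p)).const_smul μ)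
  have hs₂ : ∀ p, MemLp (s i p) 2 ℙ := h.gradient_noise.memLp i
  refine integral_inner_eq_zero_of_condExp_eq_zero (h.pastModels_le hF i)
    (hc.measurable.comp (measurable_pastModels W i)) ha₂
    (memLp_avg q (MemLp.of_eval hs₂)) ?_
  have hsum : (fun ω => avg q fun p => s i p ω) = ∑ p, q p • s i p := by
    ext1 ω
    simp [avg_apply]
  rw [hsum]
  refine (condExp_finsetSum (fun p _ => ((hs₂ p).integrable one_le_two).smul (q p)) _).trans ?_
  have h0 : ∀ᵐ ω ∂ℙ, ∀ p, ℙ[q p • s i p | pastModels W i] ω = 0 := by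
    refine ae_all_iff.2 fun p => ?_
    filter_upwards [condExp_smul (q p) (s i p) (pastModels W i) (μ := ℙ),
      h.gradient_noise.zero_mean i p] with ω h₁ h₂
    rw [h₁, Pi.smul_apply, h₂, Pi.zero_apply, smul_zero]
  filter_upwards [h0] with ω hω
  simp [hω]

theorem error_succ_le [IsProbabilityMeasure ℙ] (h : NoisyDiffusion ℙ A q μ Γ β σs wo F W η s)
    (hA : CombinationPolicy A q) (hF : GradientFields ν δ ξ q wo F)
    (hν : 0 < ν) (hδ : 0 ≤ δ) (hμ : 0 < μ) (hμν : μ * ν ≤ 1) (hμδ : μ * δ ^ 2 ≤ ν) (i : ℕ) :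
    ∫ ω, ‖wo - avg q fun p => W (i + 1) p ω‖ ^ 2 ∂ℙ
      ≤ (1 - μ * ν / 2) * ∫ ω, ‖wo - avg q fun p => W i p ω‖ ^ 2 ∂ℙ
        + 8 * δ ^ 2 / ν * μ * (∫ ω, ‖dev q fun p => W i p ω‖ ^ 2 ∂ℙ + Γ)
        + 2 * μ ^ 2 * ∫ ω, ‖fun p => s i p ω‖ ^ 2 ∂ℙ := by
  obtain ⟨hci, hc0⟩ := h.cross_term hF i
  have he := h.integrable_error hF i
  have hd := h.integrable_dev hF i
  have hη := h.integrable_noise 1 i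
  have hs := h.integrable_gradient_noise i
  have i₁ := he.const_mul (1 - μ * ν / 2)
  have i₂ := (hd.add hη).const_mul (8 * δ ^ 2 / ν * μ)
  have i₃ := hs.const_mul (2 * μ ^ 2)
  have i₄ := hci.const_mul (2 * μ)
  have hle := integral_mono_ae (h.integrable_error hF (i + 1)) (((i₁.add i₂).add i₃).add i₄) (by
    filter_upwards [h.avg_noise 0 i, h.avg_noise 1 i, h.avg_noise 2 i] with ω h₀ h₁ h₂
    rw [h.step_eq i ω]
    exact norm_sq_sub_avg_step_le hA hF hν hδ hμ hμν hμδ _ _ _ _ _ h₀ h₁ h₂)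
  refine hle.trans ?_
  rw [integral_add' ((i₁.add i₂).add i₃) i₄, integral_add' (i₁.add i₂) i₃, integral_add' i₁ i₂,
    integral_const_mul, integral_const_mul, integral_const_mul, integral_const_mul, hc0,
    integral_add' hd hη, mul_zero, add_zero]
  gcongr
  exact h.noise_le 1 i

theorem dev_succ_le [IsProbabilityMeasure ℙ] (h : NoisyDiffusion ℙ A q μ Γ β σs wo F W η s)
    (hA : CombinationPolicy A q) (hF : GradientFields ν δ ξ q wo F)
    (hδ : 0 ≤ δ) (hμ : 0 < μ) (hμ₁ : μ ≤ 1) {N : (Fin P → Param M) → ℝ} {r C : ℝ}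
    (hr₀ : 0 < r) (hr : r < 1) (hN : Continuous N) (hN_add : ∀ x y, N (x + y) ≤ N x + N y)
    (hN_ge : ∀ x, ‖x‖ ≤ N x) (hN_le : ∀ x, N x ≤ C * ‖x‖) (hC : 0 ≤ C)
    (hN_mix : ∀ x, avg q x = 0 → N (mix (A 1 * A 0 * A 2) x) ≤ r * N x) (i : ℕ) :
    ∫ ω, N (dev q fun p => W (i + 1) p ω) ^ 2 ∂ℙ
      ≤ r * ∫ ω, N (dev q fun p => W i p ω) ^ 2 ∂ℙ
        + 32 * C ^ 2 * (1 + δ ^ 2) / (1 - r) * (3 * Γ + μ ^ 2 * (∫ ω, ‖fun p => s i p ω‖ ^ 2 ∂ℙ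
          + ∫ ω, N (dev q fun p => W i p ω) ^ 2 ∂ℙ
          + ∫ ω, ‖wo - avg q fun p => W i p ω‖ ^ 2 ∂ℙ + ξ ^ 2)) := by
  have he := h.integrable_error hF i
  have hV := fun i => h.integrable_norm_dev hF hN hN_ge hN_le i
  have hη₀ := h.integrable_noise 0 i
  have hη₁ := h.integrable_noise 1 i
  have hη₂ := h.integrable_noise 2 i
  have hs := h.integrable_gradient_noise i
  have i₁ := (hV i).const_mul r
  have i₂ := (hη₀.add hη₁).add hη₂
  have i₃ := ((hs.add (hV i)).add he).add (integrable_const (ξ ^ 2))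
  have i₄ := i₂.add (i₃.const_mul (μ ^ 2))
  have hle := integral_mono (hV (i + 1))
    (i₁.add (i₄.const_mul (32 * C ^ 2 * (1 + δ ^ 2) / (1 - r)))) fun ω => by
      have := dev_step_sq_le hA hF hδ hμ hμ₁ hr₀ hr hN_add hN_ge hN_le hC hN_mix
        (fun p => W i p ω) (η 0 i ω) (η 1 i ω) (η 2 i ω) (fun p => s i p ω)
      rw [← h.step_eq i ω] at this
      exact this
  refine hle.trans ?_
  rw [integral_add' i₁ (i₄.const_mul _), integral_const_mul, integral_const_mul,
    integral_add' i₂ (i₃.const_mul _), integral_const_mul, integral_add' (hη₀.add hη₁) hη₂,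
    integral_add' hη₀ hη₁, integral_add' ((hs.add (hV i)).add he) (integrable_const _),
    integral_add' (hs.add (hV i)) he, integral_add' hs (hV i)]
  have hr' : 0 < 1 - r := by linarith
  simp only [integral_const, probReal_univ, one_smul]
  gcongr
  linarith [h.noise_le 0 i, h.noise_le 1 i, h.noise_le 2 i]

end NoisyDiffusion

end NetCentroid

end Probability

/-! ### From the algorithm to the abstract recursion, and the final bound. -/

section Centroid

namespace NetCentroid

theorem limsup_le_of_le_geometric_add {e : ℕ → ℝ} {γ K B : ℝ} (hγ₀ : 0 ≤ γ) (hγ : γ < 1)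
    (he₀ : ∀ i, 0 ≤ e i) (he : ∀ i, e i ≤ K * γ ^ i + B) : limsup e atTop ≤ B := by
  have ht : Tendsto (fun i : ℕ => K * γ ^ i + B) atTop (𝓝 B) := by
    simpa using ((tendsto_pow_atTop_nhds_zero_of_lt_one hγ₀ hγ).const_mul K).add_const B
  calc limsup e atTop ≤ limsup (fun i : ℕ => K * γ ^ i + B) atTop :=
        limsup_le_limsup (Eventually.of_forall he)
          (isCoboundedUnder_le_of_le atTop he₀) ht.isBoundedUnder_le
    _ = B := ht.limsup_eq

theorem preModels_eq {Ω : Type u} {M P : ℕ} (A : Fin 3 → Matrix (Fin P) (Fin P) ℝ) (μ : ℝ)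
    (G : ℕ → Fin P → Ω → Param M → Param M) (g : Fin 3 → ℕ → Fin P → Fin P → Ω → Param M)
    (w₀ : Fin P → Ω → Param M) (i : ℕ) (p : Fin P) (ω : Ω) :
    preModels A μ G g w₀ i p ω = (mix (A 1) (fun m => models A μ G g w₀ i m ω)
      + linkNoise (A 1) fun m p => g 1 (i + 1) m p ω) p := by
  rw [preModels, combine_eq]

variable {Ω : Type u} [MeasurableSpace Ω] {ℙ : Measure Ω} {M P : ℕ}
  {ν δ ξ μ κ σg : ℝ} {q : Fin P → ℝ} {wo : Param M} {F : Fin P → Param M → Param M}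
  {A : Fin 3 → Matrix (Fin P) (Fin P) ℝ} {g : Fin 3 → ℕ → Fin P → Fin P → Ω → Param M}
  {β σs : Fin P → ℝ}

theorem GraphHomomorphicNoise.integral_linkNoise_le (hg : GraphHomomorphicNoise ℙ A q κ σg g)
    (hA : CombinationPolicy A q) (j : Fin 3) (i : ℕ)
    (hint : Integrable (fun ω => ‖linkNoise (A j) fun m p => g j i m p ω‖ ^ 2) ℙ) :
    ∫ ω, ‖linkNoise (A j) fun m p => g j i m p ω‖ ^ 2 ∂ℙ ≤ P * (κ * σg ^ 2) := by
  have hst := hA.left_stochastic j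
  have hi : ∀ m p, Integrable (fun ω => A j m p * ‖g j i m p ω‖ ^ 2) ℙ := fun m p =>
    (integrable_norm_sq (hg.memLp j i m p)).const_mul _
  calc ∫ ω, ‖linkNoise (A j) fun m p => g j i m p ω‖ ^ 2 ∂ℙ
      ≤ ∫ ω, ∑ p, ∑ m, A j m p * ‖g j i m p ω‖ ^ 2 ∂ℙ :=
        integral_mono hint (integrable_finsetSum _ fun p _ => integrable_finsetSum _ fun m _ =>
          hi m p) fun ω => norm_linkNoise_sq_le hst _
    _ = ∑ p, ∑ m, A j m p * ∫ ω, ‖g j i m p ω‖ ^ 2 ∂ℙ := by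
        rw [integral_finsetSum _ fun p _ => integrable_finsetSum _ fun m _ => hi m p]
        refine Finset.sum_congr rfl fun p _ => ?_
        rw [integral_finsetSum _ fun m _ => hi m p]
        simp only [integral_const_mul]
    _ ≤ ∑ p, ∑ m, A j m p * (κ * σg ^ 2) := by
        gcongr with p _ m _
        · exact Matrix.nonneg_of_mem_colStochastic hst
        · exact hg.second_moment j i m p
    _ = P * (κ * σg ^ 2) := by
        simp [← Finset.sum_mul, Matrix.sum_col_of_mem_colStochastic hst]

/-- The shift `i + 1` appears because iteration `i + 1` acts on the models of index `i`, while the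
abstract process indexes its noises from zero. -/
theorem noisyDiffusion_models (hA : CombinationPolicy A q)
    {w₀ : Fin P → Ω → Param M} (hw₀ : ∀ p, Measurable (w₀ p)) (hw₀' : ∀ p, MemLp (w₀ p) 2 ℙ)
    (hg : GraphHomomorphicNoise ℙ A q κ σg g) {G : ℕ → Fin P → Ω → Param M → Param M}
    (hs : GradientNoise ℙ β σs wo (models A μ G g w₀) (preModels A μ G g w₀)
      fun i p ω => G (i + 1) p ω (preModels A μ G g w₀ i p ω)
        - F p (preModels A μ G g w₀ i p ω)) :
    NoisyDiffusion ℙ A q μ (P * (κ * σg ^ 2)) β σs wo F (models A μ G g w₀)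
      (fun j i ω => linkNoise (A j) fun m p => g j (i + 1) m p ω)
      (fun i p ω => G (i + 1) p ω (preModels A μ G g w₀ i p ω)
        - F p (preModels A μ G g w₀ i p ω)) := by
  have hmem : ∀ j i, MemLp (fun ω => linkNoise (A j) fun m p => g j (i + 1) m p ω) 2 ℙ :=
    fun j i => MemLp.of_eval fun p => memLp_finsetSum _ fun m _ =>
      (hg.memLp j (i + 1) m p).const_smul (A j m p)
  refine ⟨hw₀, hw₀', fun j i => ?_, hmem,
    fun j i => hg.integral_linkNoise_le hA j (i + 1) (integrable_norm_sq (hmem j i)),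
    fun j i => ?_, ?_, fun i ω => ?_⟩
  · exact measurable_pi_lambda _ fun p => Finset.measurable_fun_sum _ fun m _ =>
      (hg.measurable j (i + 1) m p).const_smul (A j m p)
  · filter_upwards [hg.cancel j (i + 1)] with ω hω
    rw [avg_linkNoise, hω]
  · have hφ : (fun i p ω => (mix (A 1) (fun m => models A μ G g w₀ i m ω)
        + linkNoise (A 1) fun m p => g 1 (i + 1) m p ω) p) = preModels A μ G g w₀ := by
      ext1 i
      ext1 p
      ext1 ω
      rw [preModels_eq]
    rw [hφ]
    exact hs
  · simp only [← preModels_eq, sub_add_cancel]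
    change combine (A 2) (fun p => combine (A 0) (fun p => preModels A μ G g w₀ i p ω)
      (fun m p => g 0 (i + 1) m p ω) p - μ • G (i + 1) p ω (preModels A μ G g w₀ i p ω))
      (fun m p => g 2 (i + 1) m p ω) = _
    have hφ : (mix (A 1) (fun m => models A μ G g w₀ i m ω)
        + linkNoise (A 1) fun m p => g 1 (i + 1) m p ω)
        = fun p => preModels A μ G g w₀ i p ω := funext fun p => (preModels_eq ..).symm
    rw [hφ, combine_eq, combine_eq]
    rfl

end NetCentroid

end Centroid

theorem theorem2 {P : ℕ} (A : Fin 3 → Matrix (Fin P) (Fin P) ℝ) (q : Fin P → ℝ)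
    (hA : NetCentroid.CombinationPolicy A q)
    (ν δ ξ κ : ℝ) (hν : 0 < ν) (hδ : 0 < δ) (hξ : 0 ≤ ξ) (hκ : 0 ≤ κ) (β : Fin P → ℝ) :
    ∃ μ₀ K C₁ C₂ C₃ : ℝ, 0 < μ₀ ∧ 0 ≤ K ∧ 0 ≤ C₁ ∧ 0 ≤ C₂ ∧ 0 ≤ C₃ ∧
    ∀ μ : ℝ, 0 < μ → μ < μ₀ →
    ∃ γ : ℝ, 0 < γ ∧ γ < 1 ∧
    ∀ (M : ℕ) (X : Type v) (Q : Fin P → NetCentroid.Param M → X → ℝ)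
      (N : Fin P → ℕ) (_hN : ∀ p, 0 < N p) (x : (p : Fin P) → Fin (N p) → X)
      (_hQ : NetCentroid.ConvexSmooth ν δ Q N x)
      (wo : NetCentroid.Param M) (wloc : Fin P → NetCentroid.Param M)
      (_hwo : IsMinOn
        (NetCentroid.aggregateRisk q (fun p => NetCentroid.risk (Q p) (N p) (x p))) Set.univ wo)
      (_hwloc : ∀ p, IsMinOn (NetCentroid.risk (Q p) (N p) (x p)) Set.univ (wloc p))
      (_hdrift : ∀ p, ‖wo - wloc p‖ ≤ ξ)
      (Ω : Type u) [MeasurableSpace Ω] (ℙ : Measure Ω) [IsProbabilityMeasure ℙ]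
      (σg : ℝ) (σs : Fin P → ℝ)
      (w₀ : Fin P → Ω → NetCentroid.Param M)
      (_hw₀ : ∀ p, Measurable (w₀ p)) (_hw₀' : ∀ p, MemLp (w₀ p) 2 ℙ)
      (g : Fin 3 → ℕ → Fin P → Fin P → Ω → NetCentroid.Param M)
      (_hg : NetCentroid.GraphHomomorphicNoise ℙ A q κ σg g)
      (G : ℕ → Fin P → Ω → NetCentroid.Param M → NetCentroid.Param M)
      (_hs : NetCentroid.GradientNoise ℙ β σs wo
        (NetCentroid.models A μ G g w₀) (NetCentroid.preModels A μ G g w₀)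
        (fun i p ω =>
          G (i + 1) p ω (NetCentroid.preModels A μ G g w₀ i p ω)
            - gradient (NetCentroid.risk (Q p) (N p) (x p))
                (NetCentroid.preModels A μ G g w₀ i p ω))),
      (∀ i, Integrable
        (fun ω => ‖wo - NetCentroid.centroid q (NetCentroid.models A μ G g w₀) i ω‖ ^ 2) ℙ) ∧
      (∀ i, ∫ ω, ‖wo - NetCentroid.centroid q (NetCentroid.models A μ G g w₀) i ω‖ ^ 2 ∂ℙ
        ≤ K * γ ^ i * (∑ p, ∫ ω, ‖wo - w₀ p ω‖ ^ 2 ∂ℙ)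
          + (C₁ * μ * (∑ p, σs p ^ 2) + C₂ * σg ^ 2 + C₃ * μ ^ 2)) ∧
      limsup
        (fun i => ∫ ω, ‖wo - NetCentroid.centroid q (NetCentroid.models A μ G g w₀) i ω‖ ^ 2 ∂ℙ)
        atTop
        ≤ C₁ * μ * (∑ p, σs p ^ 2) + C₂ * σg ^ 2 + C₃ * μ ^ 2 := by
  obtain ⟨r, C, hr₀, hr, hC, hnorm⟩ := NetCentroid.exists_contracting_norm hA
  have hr' : 0 < 1 - r := by linarith
  obtain ⟨μ₀, k, D₁, D₂, D₃, hμ₀, hμ₁, hμν, hk, hD₁, hD₂, hD₃, hrec⟩ :=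
    exists_coupled_recursion_bound (ν := ν) (r := r) (c₁ := 8 * δ ^ 2 / ν)
      (c₂ := 32 * C ^ 2 * (1 + δ ^ 2) / (1 - r)) (b := ∑ p, β p ^ 2) hν hr
      (by positivity) (by positivity) (by positivity)
  have hq₀ := fun p => (hA.perron_pos p).le
  -- The recursion is used with `Γ = P κ σg²` and `Z = ξ²`. The cap `ν / δ²` is for the gradient
  -- step, and `4 k C²` bounds the initial disagreement.
  refine ⟨min μ₀ (ν / δ ^ 2), 1 + 4 * k * C ^ 2, D₁, D₂ * (P * κ), D₃ * ξ ^ 2,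
    lt_min hμ₀ (by positivity), by positivity, hD₁, by positivity, by positivity, ?_⟩
  intro μ hμ hμlt
  have hμμ₀ : μ < μ₀ := hμlt.trans_le (min_le_left _ _)
  have hμδ : μ * δ ^ 2 ≤ ν := (le_div_iff₀ (by positivity)).1 (hμlt.le.trans (min_le_right _ _))
  have hμν' : μ * ν ≤ 1 := (mul_le_mul_of_nonneg_right hμμ₀.le hν.le).trans hμν
  have hμν₀ : 0 < μ * ν := mul_pos hμ hν
  refine ⟨1 - μ * ν / 4, by linarith, by linarith, ?_⟩
  intro M X Q N hN x hQ wo wloc hwo hwloc hdrift Ω _ ℙ _ σg σs w₀ hw₀ hw₀' g hg G hs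
  have hF := hQ.gradientFields hδ.le hN hwo hwloc hdrift
  obtain ⟨n, hn_cont, hn_add, hn_ge, hn_le, hn_mix⟩ := hnorm M
  have hW := NetCentroid.noisyDiffusion_models (μ := μ)
    (F := fun p => gradient (NetCentroid.risk (Q p) (N p) (x p))) hA hw₀ hw₀' hg hs
  set W := NetCentroid.models A μ G g w₀ with hW_def
  -- The error and gradient-noise bounds use the sup norm, the disagreement recursion the adapted
  -- one, which dominates it.
  have hdev : ∀ i, ∫ ω, ‖NetCentroid.dev q fun p => W i p ω‖ ^ 2 ∂ℙ
      ≤ ∫ ω, n (NetCentroid.dev q fun p => W i p ω) ^ 2 ∂ℙ := fun i =>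
    integral_mono (hW.integrable_dev hF i) (hW.integrable_norm_dev hF hn_cont hn_ge hn_le i)
      fun ω => pow_le_pow_left₀ (norm_nonneg _) (hn_ge _) 2
  have hbound := hrec μ (∑ p, σs p ^ 2) (P * (κ * σg ^ 2)) (ξ ^ 2)
    (fun i => ∫ ω, ‖wo - NetCentroid.avg q fun p => W i p ω‖ ^ 2 ∂ℙ)
    (fun i => ∫ ω, n (NetCentroid.dev q fun p => W i p ω) ^ 2 ∂ℙ) _ hμ hμμ₀
    (by positivity) (by positivity) (by positivity)
    (fun i => integral_nonneg fun ω => sq_nonneg _) (fun i => integral_nonneg fun ω => sq_nonneg _)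
    (fun i => (hW.gradient_noise_le hA hF i).trans
      (by gcongr 3 * _ * (_ + ?_ + _) + _; exact hdev i))
    (fun i => (hW.error_succ_le hA hF hν hδ.le hμ hμν' hμδ i).trans
      (by gcongr _ + _ * (?_ + _) + _; exact hdev i))
    (hW.dev_succ_le hA hF hδ.le hμ (hμμ₀.le.trans hμ₁) hr₀ hr hn_cont hn_add hn_ge hn_le hC hn_mix)
  have hw₀i : ∀ p, Integrable (fun ω => ‖wo - w₀ p ω‖ ^ 2) ℙ := fun p =>
    NetCentroid.integrable_norm_sq ((memLp_const wo).sub (hw₀' p))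
  have hinit : ∀ ω, ‖(fun _ => wo) - fun p => w₀ p ω‖ ^ 2 ≤ ∑ p, ‖wo - w₀ p ω‖ ^ 2 := fun ω =>
    NetCentroid.pi_norm_sq_le_sum _
  have he₀ : ∫ ω, ‖wo - NetCentroid.avg q fun p => W 0 p ω‖ ^ 2 ∂ℙ
      ≤ ∑ p, ∫ ω, ‖wo - w₀ p ω‖ ^ 2 ∂ℙ := by
    rw [← integral_finsetSum _ fun p _ => hw₀i p]
    refine integral_mono (hW.integrable_error hF 0) (integrable_finsetSum _ fun p _ => hw₀i p)
      fun ω => le_trans ?_ (hinit ω)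
    have h : wo - NetCentroid.avg q (fun p => W 0 p ω)
        = NetCentroid.avg q ((fun _ => wo) - fun p => w₀ p ω) := by
      rw [map_sub, NetCentroid.avg_const hA.perron_sum]
      rfl
    simp only [h]
    exact pow_le_pow_left₀ (norm_nonneg _) (NetCentroid.norm_avg_le hq₀ hA.perron_sum _) 2
  have hV₀ : ∫ ω, n (NetCentroid.dev q fun p => W 0 p ω) ^ 2 ∂ℙ
      ≤ 4 * C ^ 2 * ∑ p, ∫ ω, ‖wo - w₀ p ω‖ ^ 2 ∂ℙ := by
    rw [← integral_finsetSum _ fun p _ => hw₀i p, ← integral_const_mul]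
    refine integral_mono (hW.integrable_norm_dev hF hn_cont hn_ge hn_le 0)
      ((integrable_finsetSum _ fun p _ => hw₀i p).const_mul _)
      fun ω => le_trans ?_ (mul_le_mul_of_nonneg_left (hinit ω) (by positivity))
    -- Deviations ignore the constant vector `wo`, so the initial disagreement is controlled by the
    -- initial errors.
    have h : NetCentroid.dev q (fun p => W 0 p ω)
        = -NetCentroid.dev q ((fun _ => wo) - fun p => w₀ p ω) := by
      rw [map_sub, NetCentroid.dev_const hA.perron_sum, zero_sub, neg_neg]
      rfl
    have h₁ := hn_le (NetCentroid.dev q fun p => W 0 p ω)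
    have h₂ := NetCentroid.norm_dev_le hq₀ hA.perron_sum ((fun _ => wo) - fun p => w₀ p ω)
    rw [h, norm_neg, ← h] at h₁
    have h₃ := pow_le_pow_left₀ ((norm_nonneg _).trans (hn_ge _))
      (h₁.trans (mul_le_mul_of_nonneg_left h₂ hC)) 2
    exact h₃.trans (le_of_eq (by ring))
  have hfinal : ∀ i, ∫ ω, ‖wo - NetCentroid.centroid q W i ω‖ ^ 2 ∂ℙ
      ≤ (1 + 4 * k * C ^ 2) * (1 - μ * ν / 4) ^ i * (∑ p, ∫ ω, ‖wo - w₀ p ω‖ ^ 2 ∂ℙ)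
        + (D₁ * μ * (∑ p, σs p ^ 2) + D₂ * (P * κ) * σg ^ 2 + D₃ * ξ ^ 2 * μ ^ 2) := by
    intro i
    refine (hbound i).trans ?_
    have hpow : 0 ≤ (1 - μ * ν / 4) ^ i := pow_nonneg (by linarith) i
    have h := mul_le_mul_of_nonneg_left (add_le_add he₀ (mul_le_mul_of_nonneg_left hV₀ hk)) hpow
    linarith
  refine ⟨hW.integrable_error hF, hfinal, ?_⟩
  exact NetCentroid.limsup_le_of_le_geometric_add (γ := 1 - μ * ν / 4)
    (K := (1 + 4 * k * C ^ 2) * ∑ p, ∫ ω, ‖wo - w₀ p ω‖ ^ 2 ∂ℙ) (by linarith) (by linarith)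
    (fun i => integral_nonneg fun ω => sq_nonneg _)
    (fun i => (hfinal i).trans (le_of_eq (by ring)))
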